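/- For each of the 17 types of wallpaper groups (p1, p2, pm, pg, cm, pmm, pmg, pgg, cmm, p4, p4m, p4g, p3, p3m1, p31m, p6, p6m) there exists a deployable periodic monotile kirigami pattern whose initial configuration has a symmetry group of that type. Here: A periodic monotile kirigami pattern consists of one polygonal tile $T\subset\mathbb{R}^2$ (a finite union of convex polygons that is homeomorphic to a closed disk) and of tiles indexed by $\{1,\dots,n\}\times\mathbb{Z}^2$, together with finitely many hinges up to $\mathbb{Z}^2$-translation of the indices. Each hinge joins one point of a tile to one point of another tile, two tiles share at most one hinge, and the hinges join all the tiles into one connected structure. A configuration of the pattern places every tile as an image of $T$ under a rotation and a translation, periodically: the tile $(k,(p,q))$ is the tile $(k,(0,0))$ translated by $p\,a+q\,b$, where $a,b\in\mathbb{R}^2$ are linearly independent. Different tiles have disjoint interiors, and at every hinge the two joined points coincide. Its symmetry group is the group of all isometries of the plane that map the set of placed tiles onto itself; it is of a given wallpaper type if it is conjugate, by an affine map of the plane, to the standard wallpaper group of that type. The pattern is deployable from a configuration if there is a continuous path of configurations of the same pattern (with the same tile and the same hinges; the positions and rotations of the tiles and the periods $a,b$ vary continuously), starting at that configuration and ending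 at a configuration whose unit cell, spanned by $a,b$, has strictly larger area. -/

import Mathlib

/-! The Euclidean plane is `ℂ`. Direct isometries (compositions of rotations and translations)
are the maps `z ↦ u * z + w` with `u` on the unit circle. -/

namespace Kirigami

/-! ### The 17 wallpaper groups -/

/-- The 17 types of wallpaper groups. -/
inductive WallpaperType
  | p1 | p2 | pm | pg | cm | pmm | pmg | pgg | cmm
  | p4 | p4m | p4g | p3 | p3m1 | p31m | p6 | p6m

namespace WallpaperType

/-- The generator of the rotations about the origin, in lattice coordinates. For `p3`, `p3m1`,
`p31m`, `p6`, `p6m` the two basis vectors of the lattice make an angle of 120 degrees. -/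
def rotation : WallpaperType → Matrix (Fin 2) (Fin 2) ℝ
  | p1 | pm | pg | cm => 1
  | p2 | pmm | pmg | pgg | cmm => !![-1, 0; 0, -1]
  | p4 | p4m | p4g => !![0, -1; 1, 0]
  | p3 | p3m1 | p31m => !![0, -1; 1, -1]
  | p6 | p6m => !![1, -1; 1, 0]

/-- One reflection or glide reflection `v ↦ M v + s` of the group, in lattice coordinates;
`none` for the groups that contain only direct isometries. For `cm` and `cmm` the coordinates
are those of a primitive basis (two vectors that the reflection swaps). -/
noncomputable def reflection :
    WallpaperType → Option (Matrix (Fin 2) (Fin 2) ℝ × (Fin 2 → ℝ))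
  | p1 | p2 | p4 | p3 | p6 => none
  | pm | pmm | p4m => some (!![-1, 0; 0, 1], ![0, 0])
  | pg => some (!![-1, 0; 0, 1], ![0, 1 / 2])
  | pmg => some (!![-1, 0; 0, 1], ![1 / 2, 0])
  | pgg | p4g => some (!![-1, 0; 0, 1], ![1 / 2, 1 / 2])
  | cm | cmm | p31m | p6m => some (!![0, 1; 1, 0], ![0, 0])
  | p3m1 => some (!![0, -1; -1, 0], ![0, 0])

/-- The standard wallpaper group of type `X` in lattice coordinates, as a set of affine maps of
`ℝ²`: all `T ∘ R ^ k` and all `T ∘ R ^ k ∘ S`, where `T` runs over the integer translations, `R` is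
the rotation generator and `S` is the chosen (glide) reflection, if there is one. -/
def model (X : WallpaperType) : Set ((Fin 2 → ℝ) → (Fin 2 → ℝ)) :=
  {f | ∃ (k : ℕ) (m : Fin 2 → ℤ), ∀ v, f v = (X.rotation ^ k).mulVec v + fun i => (m i : ℝ)} ∪
  {f | ∃ S ∈ X.reflection, ∃ (k : ℕ) (m : Fin 2 → ℤ),
    ∀ v, f v = (X.rotation ^ k).mulVec (S.1.mulVec v + S.2) + fun i => (m i : ℝ)}

end WallpaperType

/-- The point with coordinates `v` in the affine frame with origin `o` and basis `a`, `b`. -/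
noncomputable def frame (o a b : ℂ) (v : Fin 2 → ℝ) : ℂ := o + v 0 * a + v 1 * b

/-- A group `G` of isometries of the plane is a wallpaper group of type `X`: in some affine frame
of the plane, the elements of `G` are exactly the maps of the standard group of type `X`. -/
def IsWallpaperGroup (G : Subgroup (ℂ ≃ᵢ ℂ)) (X : WallpaperType) : Prop :=
  ∃ o a b : ℂ, LinearIndependent ℝ ![a, b] ∧
    (∀ g ∈ G, ∃ f ∈ X.model, ∀ v, g (frame o a b v) = frame o a b (f v)) ∧
    (∀ f ∈ X.model, ∃ g ∈ G, ∀ v, g (frame o a b v) = frame o a b (f v))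

/-- The symmetry group of a family `𝒯` of subsets of the plane: all isometries that map members
of `𝒯` to members of `𝒯` and nothing else to members of `𝒯`. -/
def symmetryGroup (𝒯 : Set (Set ℂ)) : Subgroup (ℂ ≃ᵢ ℂ) where
  carrier := {g | ∀ S : Set ℂ, g '' S ∈ 𝒯 ↔ S ∈ 𝒯}
  one_mem' := by
    intro S
    have h : ((1 : ℂ ≃ᵢ ℂ) : ℂ → ℂ) '' S = S := by
      ext z; simp
    rw [h]
  mul_mem' := by
    intro g h hg hh S
    have e : ((g * h : ℂ ≃ᵢ ℂ) : ℂ → ℂ) '' S = g '' (h '' S) := by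
      rw [Set.image_image]; rfl
    rw [e, hg, hh]
  inv_mem' := by
    intro g hg S
    have e : g '' (((g⁻¹ : ℂ ≃ᵢ ℂ) : ℂ → ℂ) '' S) = S := by
      rw [Set.image_image]; simp
    rw [← hg, e]

/-! ### Monotile kirigami patterns -/

/-- A polygonal tile: a finite union of convex polygons that is a topological closed disk. -/
structure IsPolygonalTile (T : Set ℂ) : Prop where
  polygonal : ∃ F : Finset (Finset ℂ), T = ⋃ S ∈ F, convexHull ℝ (S : Set ℂ)
  disk : Nonempty (T ≃ₜ Metric.closedBall (0 : ℂ) 1)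

/-- The design of a periodic monotile kirigami pattern: one prototile, the number of tiles in a
unit cell, and the point connections between tiles. The tiles are indexed by
`Fin n × (ℤ × ℤ)` (place in the cell, cell). A bond `(k, l, d)` says that, for every cell `e`, the
tile `(k, e)` is hinged to the tile `(l, e + d)`; the hinge is the point `src (k, l, d)` of the
first tile and the point `tgt (k, l, d)` of the second one, in the coordinates of the prototile. -/
structure Pattern where
  tile : Set ℂ
  isPolygonalTile : IsPolygonalTile tile
  n : ℕ
  bonds : Finset (Fin n × Fin n × (ℤ × ℤ))
  src : Fin n × Fin n × (ℤ × ℤ) → ℂ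
  tgt : Fin n × Fin n × (ℤ × ℤ) → ℂ
  src_mem : ∀ e ∈ bonds, src e ∈ tile
  tgt_mem : ∀ e ∈ bonds, tgt e ∈ tile
  /-- No tile is hinged to itself, and two tiles have at most one hinge in common. -/
  simple : ∀ k l d, (k, l, d) ∈ bonds → (l, k, -d) ∉ bonds
  /-- The tiles are joined by the hinges into one connected structure. -/
  connected : (SimpleGraph.fromRel fun i j : Fin n × (ℤ × ℤ) =>
    (i.1, j.1, j.2 - i.2) ∈ bonds).Connected

/-- A periodic placement of the tiles in the plane: a rotation and a position for each of the `n`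
tiles of the unit cell, and the two period vectors `a`, `b`. -/
structure Placement (n : ℕ) where
  rot : Fin n → Circle
  pos : Fin n → ℂ
  a : ℂ
  b : ℂ

namespace Placement

variable {n : ℕ}

/-- The direct isometry that puts the prototile in the place of the tile with index `i`. -/
noncomputable def map (c : Placement n) (i : Fin n × (ℤ × ℤ)) (z : ℂ) : ℂ :=
  (c.rot i.1 : ℂ) * z + c.pos i.1 + (i.2.1 : ℂ) * c.a + (i.2.2 : ℂ) * c.b

/-- The area of the unit cell, the parallelogram spanned by the period vectors. -/
noncomputable def cellArea (c : Placement n) : ℝ := |((starRingEnd ℂ) c.a * c.b).im|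

end Placement

namespace Pattern

/-- The family of all placed tiles. -/
def tiles (P : Pattern) (c : Placement P.n) : Set (Set ℂ) :=
  Set.range fun i : Fin P.n × (ℤ × ℤ) => c.map i '' P.tile

/-- A configuration of the pattern: a placement with independent periods, in which tiles do not
overlap and every hinge is closed. -/
structure IsConfiguration (P : Pattern) (c : Placement P.n) : Prop where
  periods : 0 < c.cellArea
  disjoint : Pairwise fun i j : Fin P.n × (ℤ × ℤ) =>
    Disjoint (interior (c.map i '' P.tile)) (interior (c.map j '' P.tile))
  hinge : ∀ k l d, (k, l, d) ∈ P.bonds →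
    c.map (k, 0) (P.src (k, l, d)) = c.map (l, d) (P.tgt (k, l, d))

/-- The pattern is deployable from `c`: it can be moved continuously, through configurations
(rigid tiles, no overlap, all connections kept), from `c` to a configuration with a larger unit
cell. -/
def IsDeployable (P : Pattern) (c : Placement P.n) : Prop :=
  ∃ γ : ℝ → Placement P.n, γ 0 = c ∧
    (∀ k, ContinuousOn (fun t => (γ t).rot k) (Set.Icc 0 1)) ∧
    (∀ k, ContinuousOn (fun t => (γ t).pos k) (Set.Icc 0 1)) ∧
    ContinuousOn (fun t => (γ t).a) (Set.Icc 0 1) ∧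
    ContinuousOn (fun t => (γ t).b) (Set.Icc 0 1) ∧
    (∀ t ∈ Set.Icc (0 : ℝ) 1, P.IsConfiguration (γ t)) ∧
    c.cellArea < (γ 1).cellArea

end Pattern

end Kirigami

namespace Kirigami

open Complex ComplexConjugate

/-! ### The kite -/

/-! Take a periodic mesh of edges in the square or hexagonal lattice. Replace each edge by two thin
kites, hinged to each other at the end `1` of their axes and hinged at the vertices of the mesh at
the end `0`. Bend every edge by the same angle `α` to one of its sides, chosen edge by edge. The two
unit axes of an edge span the distance `2 * cos α` for either side (`tileMap_mate`), so the vertices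
form the lattice scaled by `2 * cos α`. Unbending all edges together is therefore a motion of the
whole structure, and the cell area, proportional to `cos α ^ 2`, grows (`Mesh.isDeployable`). Kites
never collide, because each stays in a narrow sector inside the Voronoi cell of its vertex
(`disjoint_tiles`).

The choice of sides controls the symmetry. A kite determines the two ends of its axis, in order
(`ends_eq_of_image_kite_eq`), and the initial angle is too small for a bent direction to come from
two different lattice directions (`eq_of_emb_mul_exp_eq`). Hence the symmetries of the initial
configuration are exactly the lattice isometries that preserve the mesh, where direct ones keep the
bends and indirect ones, which exchange left and right, negate them (`exists_lattice_isometry`,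
`isSymmetry_of_mem`, `mem_symmetryGroup_of_isSymmetry`).

The mesh is periodic modulo `M`, so its group can be certified by finitely many checks
(`IsMesh.hasGroup`). From generators, and the absence of other symmetries,
`HasGroup.isWallpaperGroup` recovers the wallpaper type. What remains is one table for each type,
checked by computation (`design_hasGroup`). -/

/-- The vertices of the prototile. -/
noncomputable def kiteVertices : Finset ℂ := {0, 1, ⟨1 / 4, 1 / 24⟩, ⟨1 / 4, -1 / 24⟩}

/-- The prototile: a thin kite with axis from `0` to `1`. -/
noncomputable def kite : Set ℂ := convexHull ℝ (kiteVertices : Set ℂ)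

lemma vertices_subset_kite : (kiteVertices : Set ℂ) ⊆ kite := subset_convexHull ℝ _

lemma zero_mem_kite : (0 : ℂ) ∈ kite := vertices_subset_kite (by simp [kiteVertices])

lemma one_mem_kite : (1 : ℂ) ∈ kite := vertices_subset_kite (by simp [kiteVertices])

lemma kite_subset_halfPlane (p q r : ℝ) (h : ∀ z ∈ kiteVertices, p * z.re + q * z.im ≤ r)
    {z : ℂ} (hz : z ∈ kite) : p * z.re + q * z.im ≤ r := by
  have hc : Convex ℝ {z : ℂ | p * z.re + q * z.im ≤ r} := by
    apply convex_halfSpace_le (f := fun z : ℂ => p * z.re + q * z.im)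
    constructor
    · intro x y; simp; ring
    · intro t x; simp; ring
  exact convexHull_min (fun z hz => h z (by simpa using hz)) hc hz

/-- These are the four sides of the kite: lines of slope `±1/6` through `0` and `±1/18` through `1`.
-/
lemma abs_im_le_of_mem_kite {z : ℂ} (hz : z ∈ kite) :
    |z.im| ≤ z.re / 6 ∧ |z.im| ≤ (1 - z.re) / 18 := by
  have h1 := kite_subset_halfPlane (-1 / 6) 1 0 (by simp [kiteVertices]; norm_num) hz
  have h2 := kite_subset_halfPlane (-1 / 6) (-1) 0 (by simp [kiteVertices]; norm_num) hz
  have h3 := kite_subset_halfPlane (1 / 18) 1 (1 / 18) (by simp [kiteVertices]; norm_num) hz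
  have h4 := kite_subset_halfPlane (1 / 18) (-1) (1 / 18) (by simp [kiteVertices]; norm_num) hz
  constructor <;> rw [abs_le] <;> constructor <;> linarith

/-- A compact convex set with interior points is a closed disk; three non-collinear vertices provide
the interior. -/
lemma isPolygonalTile_kite : IsPolygonalTile kite := by
  refine ⟨⟨{kiteVertices}, by simp [kite]⟩, ?_⟩
  have hcompact : IsCompact kite := (Finset.finite_toSet _).isCompact_convexHull ℝ
  have hint : (interior kite).Nonempty := by
    have hi : AffineIndependent ℝ ![(0 : ℂ), 1, ⟨1 / 4, 1 / 24⟩] := by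
      rw [affineIndependent_iff_linearIndependent_vsub ℝ _ (0 : Fin 3)]
      rw [← linearIndependent_equiv (finSuccAboveEquiv (0 : Fin 3))]
      have hl : LinearIndependent ℝ ![(1 : ℂ), ⟨1 / 4, 1 / 24⟩] := by
        rw [LinearIndependent.pair_iff' one_ne_zero]
        intro t ht
        have := congrArg Complex.im ht
        simp at this
      convert hl using 1
      · funext i
        fin_cases i <;> simp [finSuccAboveEquiv_apply, Fin.succAbove]
      · rfl
      · rfl
    have htop := hi.affineSpan_eq_top_iff_card_eq_finrank_add_one.2 (by simp)
    have := (interior_convexHull_nonempty_iff_affineSpan_eq_top (V := ℂ)).2 htop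
    refine this.mono (interior_mono (convexHull_mono ?_))
    rintro _ ⟨i, rfl⟩
    fin_cases i <;> simp [kiteVertices]
  obtain ⟨h, -, h2, -⟩ := exists_homeomorph_image_interior_closure_frontier_eq_unitBall
    (s := kite) (convex_convexHull ℝ _) hint hcompact.isBounded
  rw [hcompact.isClosed.closure_eq] at h2
  exact ⟨(h.image kite).trans (Homeomorph.setCongr h2)⟩

lemma eq_ends_of_dist_eq_one {z w : ℂ} (hz : z ∈ kite) (hw : w ∈ kite) (h : dist z w = 1) :
    z = 0 ∧ w = 1 ∨ z = 1 ∧ w = 0 := by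
  wlog hle : z.re ≤ w.re generalizing z w
  · rcases this hw hz (by rwa [dist_comm]) (by linarith) with h | h
    · exact Or.inr h.symm
    · exact Or.inl h.symm
  left
  obtain ⟨hz1, -⟩ := abs_im_le_of_mem_kite hz
  obtain ⟨-, hw2⟩ := abs_im_le_of_mem_kite hw
  have h1 : (z.re - w.re) ^ 2 + (z.im - w.im) ^ 2 = 1 := by
    have := Complex.dist_eq_re_im z w
    rw [h] at this
    have h' := Real.sqrt_eq_one.1 this.symm
    exact h'
  obtain ⟨a1, a2⟩ := abs_le.1 hz1
  obtain ⟨b1, b2⟩ := abs_le.1 hw2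
  -- Let `s` be this sum. The horizontal distance is `1 - s` and the vertical one at most `s / 6`,
  -- so for `0 < s ≤ 1` the points are closer than `1`.
  have hr : z.re + (1 - w.re) = 0 := by
    by_contra hne
    have hpos : 0 < z.re + (1 - w.re) := lt_of_le_of_ne (by linarith) (Ne.symm hne)
    have hy : (z.im - w.im) ^ 2 ≤ ((z.re + (1 - w.re)) / 6) ^ 2 := by
      apply sq_le_sq' <;> linarith
    nlinarith
  have e1 : z.re = 0 := by linarith
  have e2 : w.re = 1 := by linarith
  constructor <;> apply Complex.ext <;> simp <;> linarith

/-- The two ends of the axis of the kite are determined by the kite, even up to reflection. -/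
lemma ends_eq_of_image_kite_eq {f g : ℂ → ℂ} (hf : Isometry f) (hg : Isometry g)
    (h : f '' kite = g '' kite) : f 0 = g 0 ∧ f 1 = g 1 := by
  obtain ⟨p, hp, hp'⟩ : f 0 ∈ g '' kite := h ▸ ⟨0, zero_mem_kite, rfl⟩
  obtain ⟨q, hq, hq'⟩ : f 1 ∈ g '' kite := h ▸ ⟨1, one_mem_kite, rfl⟩
  have hd : dist p q = 1 := by
    rw [← hg.dist_eq, hp', hq', hf.dist_eq]; simp
  rcases eq_ends_of_dist_eq_one hp hq hd with ⟨rfl, rfl⟩ | ⟨rfl, rfl⟩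
  · exact ⟨hp'.symm, hq'.symm⟩
  -- If the ends were exchanged, the side vertex would land at real part `3/4` and height `1/24`,
  -- where the kite only reaches height `1/72`.
  exfalso
  have hv : (⟨1 / 4, 1 / 24⟩ : ℂ) ∈ kite := vertices_subset_kite (by simp [kiteVertices])
  obtain ⟨r, hr, hr'⟩ : f ⟨1 / 4, 1 / 24⟩ ∈ g '' kite := h ▸ ⟨_, hv, rfl⟩
  have d1 : dist r 1 = dist (⟨1 / 4, 1 / 24⟩ : ℂ) 0 := by
    rw [← hg.dist_eq, hp', hr', hf.dist_eq]
  have d0 : dist r 0 = dist (⟨1 / 4, 1 / 24⟩ : ℂ) 1 := by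
    rw [← hg.dist_eq, hq', hr', hf.dist_eq]
  rw [Complex.dist_eq_re_im, Complex.dist_eq_re_im, Real.sqrt_inj (by positivity) (by positivity)]
    at d0 d1
  simp at d0 d1
  obtain ⟨-, h2⟩ := abs_im_le_of_mem_kite hr
  have hre : r.re = 3 / 4 := by nlinarith
  rw [hre] at h2 d1
  obtain ⟨c1, c2⟩ := abs_le.1 h2
  nlinarith

/-- A kite that is turned by a small angle about its sharp end stays in a narrow sector. -/
lemma turned_kite_bounds {p q : ℝ} (hp : 0 ≤ p) (hq : |q| ≤ p / 4) {z : ℂ} (hz : z ∈ kite) :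
    0 ≤ (⟨p, q⟩ * z : ℂ).re ∧ (⟨p, q⟩ * z : ℂ).re ≤ p ∧
      |(⟨p, q⟩ * z : ℂ).im| ≤ (⟨p, q⟩ * z : ℂ).re / 2 := by
  obtain ⟨h1, h2⟩ := abs_im_le_of_mem_kite hz
  have hx : 0 ≤ z.re := by linarith [abs_nonneg z.im]
  have hy : |q * z.im| ≤ p * |z.im| / 4 := by
    rw [abs_mul]; nlinarith [abs_nonneg z.im]
  have hx' : |q * z.re| ≤ p * z.re / 4 := by
    rw [abs_mul, abs_of_nonneg hx]; nlinarith
  have hpy : |p * z.im| = p * |z.im| := by rw [abs_mul, abs_of_nonneg hp]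
  have k1 : p * |z.im| ≤ p * (z.re / 6) := mul_le_mul_of_nonneg_left h1 hp
  have k2 : p * |z.im| ≤ p * ((1 - z.re) / 18) := mul_le_mul_of_nonneg_left h2 hp
  have k3 : 0 ≤ p * z.re := mul_nonneg hp hx
  have k4 : 0 ≤ p * |z.im| := mul_nonneg hp (abs_nonneg _)
  obtain ⟨a1, a2⟩ := abs_le.1 hy
  simp only [Complex.mul_re, Complex.mul_im]
  -- The tilt has slope at most `1/4` and the kite, seen from `0`, slope at most `1/6`. Adding the
  -- angles gives slope at most `10/23 < 1/2`.
  refine ⟨by linarith, by linarith, (abs_add_le _ _).trans ?_⟩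
  rw [hpy]
  linarith

/-! ### The square and the hexagonal lattice -/

/-- The second basis vector of the square (`c = 0`) or hexagonal (`c = 1`) lattice. -/
noncomputable def zeta (c : ℤ) : ℂ := ⟨c / 2, √(1 - (c : ℝ) ^ 2 / 4)⟩

/-- The lattice point with coordinates `v`. -/
noncomputable def emb (c : ℤ) (v : ℤ × ℤ) : ℂ := v.1 + v.2 * zeta c

/-- Complex multiplication in lattice coordinates. -/
def lmul (c : ℤ) (v w : ℤ × ℤ) : ℤ × ℤ :=
  (v.1 * w.1 - v.2 * w.2, v.1 * w.2 + v.2 * w.1 + c * v.2 * w.2)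

/-- Complex conjugation in lattice coordinates. -/
def lconj (c : ℤ) (v : ℤ × ℤ) : ℤ × ℤ := (v.1 + c * v.2, -v.2)

/-- The squared absolute value in lattice coordinates. -/
def lnorm (c : ℤ) (v : ℤ × ℤ) : ℤ := v.1 ^ 2 + c * v.1 * v.2 + v.2 ^ 2

section lattice

variable {c : ℤ}

@[simp] lemma emb_zero : emb c 0 = 0 := by simp [emb]

@[simp] lemma emb_one : emb c (1, 0) = 1 := by simp [emb]

@[simp] lemma emb_add (v w : ℤ × ℤ) : emb c (v + w) = emb c v + emb c w := by
  simp [emb]; ring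

@[simp] lemma emb_neg (v : ℤ × ℤ) : emb c (-v) = -emb c v := by
  simp [emb]; ring

@[simp] lemma emb_sub (v w : ℤ × ℤ) : emb c (v - w) = emb c v - emb c w := by
  simp [emb]; ring

lemma zeta_im_sq (hc : c = 0 ∨ c = 1) : (zeta c).im ^ 2 = 1 - (c : ℝ) ^ 2 / 4 := by
  rw [zeta, Real.sq_sqrt]
  rcases hc with rfl | rfl <;> norm_num

lemma zeta_im_pos (hc : c = 0 ∨ c = 1) : 0 < (zeta c).im := by
  apply Real.sqrt_pos.2
  rcases hc with rfl | rfl <;> norm_num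

lemma zeta_mul_self (hc : c = 0 ∨ c = 1) : zeta c * zeta c = c * zeta c - 1 := by
  have h := zeta_im_sq hc
  have h' : (zeta c).re = c / 2 := rfl
  apply Complex.ext
  · simp [h']; linarith
  · simp [h']; ring

lemma conj_zeta : conj (zeta c) = c - zeta c := by
  have h' : (zeta c).re = c / 2 := rfl
  apply Complex.ext
  · simp [h']; ring
  · simp

lemma emb_lmul (hc : c = 0 ∨ c = 1) (v w : ℤ × ℤ) : emb c (lmul c v w) = emb c v * emb c w := by
  have := zeta_mul_self hc
  simp only [emb, lmul]
  push_cast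
  linear_combination (-(v.2 : ℂ) * w.2) * this

lemma emb_lconj (v : ℤ × ℤ) : emb c (lconj c v) = conj (emb c v) := by
  simp only [emb, lconj, map_add, map_mul, conj_zeta, map_intCast]
  push_cast
  ring

lemma emb_re (v : ℤ × ℤ) : (emb c v).re = v.1 + c / 2 * v.2 := by
  simp [emb, zeta]; ring

lemma emb_im (v : ℤ × ℤ) : (emb c v).im = v.2 * (zeta c).im := by
  simp [emb]

lemma emb_injective (hc : c = 0 ∨ c = 1) : Function.Injective (emb c) := by
  intro v w h
  have h2 := congrArg Complex.im h
  have h1 := congrArg Complex.re h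
  rw [emb_im, emb_im] at h2
  have e2 : (v.2 : ℝ) = w.2 := mul_right_cancel₀ (zeta_im_pos hc).ne' h2
  rw [emb_re, emb_re, e2] at h1
  have e1 : (v.1 : ℝ) = w.1 := by linarith
  exact Prod.ext (by exact_mod_cast e1) (by exact_mod_cast e2)

lemma emb_mul_conj (hc : c = 0 ∨ c = 1) (v : ℤ × ℤ) :
    emb c v * conj (emb c v) = lnorm c v := by
  have := zeta_mul_self hc
  simp only [emb, map_add, map_mul, conj_zeta, map_intCast, lnorm]
  push_cast
  linear_combination (-(v.2 : ℂ) ^ 2) * this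

lemma norm_emb_sq (hc : c = 0 ∨ c = 1) (v : ℤ × ℤ) : ‖emb c v‖ ^ 2 = lnorm c v := by
  have h := emb_mul_conj hc v
  rw [Complex.mul_conj, Complex.normSq_eq_norm_sq] at h
  exact_mod_cast h

lemma norm_emb_eq_one (hc : c = 0 ∨ c = 1) {v : ℤ × ℤ} : ‖emb c v‖ = 1 ↔ lnorm c v = 1 := by
  have h := norm_emb_sq hc v
  constructor
  · intro h1
    rw [h1] at h
    have h' : ((lnorm c v : ℤ) : ℝ) = 1 := by rw [← h]; norm_num
    exact_mod_cast h'
  · intro h1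
    rw [h1] at h
    have : ‖emb c v‖ ^ 2 = 1 := by rw [h]; norm_num
    exact (pow_eq_one_iff_of_nonneg (norm_nonneg _) two_ne_zero).1 this

lemma unit_mul_conj (hc : c = 0 ∨ c = 1) {u : ℤ × ℤ} (hu : lnorm c u = 1) :
    emb c u * conj (emb c u) = 1 := by
  rw [emb_mul_conj hc, hu]; simp

/-- The sectors `|Im| ≤ Re / 2` fit into the Voronoi cells of the lattice. -/
lemma re_add_half_abs_im_le (hc : c = 0 ∨ c = 1) (v : ℤ × ℤ) :
    (emb c v).re + |(emb c v).im| / 2 ≤ ‖emb c v‖ ^ 2 := by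
  rw [norm_emb_sq hc, emb_re, emb_im, abs_mul, abs_of_pos (zeta_im_pos hc)]
  have h := zeta_im_sq hc
  have hp := zeta_im_pos hc
  have key : ∀ x y : ℤ, x + |y| ≤ x ^ 2 + y ^ 2 := by
    intro x y
    have : |y| ≤ y ^ 2 := by
      rw [← sq_abs]
      nlinarith [Int.le_self_sq |y|, Int.le_self_sq |y|]
    linarith [Int.le_self_sq x]
  rcases hc with rfl | rfl
  · have k := key v.1 v.2
    have k' : (v.1 : ℝ) + |(v.2 : ℝ)| ≤ v.1 ^ 2 + v.2 ^ 2 := by exact_mod_cast k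
    simp only [lnorm]
    push_cast at h ⊢
    have h1 : (zeta 0).im ≤ 1 := by nlinarith
    nlinarith [abs_nonneg (v.2 : ℝ)]
  -- The right side is `x ^ 2 + y ^ 2 + (x + y) ^ 2`; apply `n ≤ n ^ 2` to `x`, `x + y` and `±y`.
  · have k : 2 * v.1 + v.2 + |v.2| ≤ 2 * (v.1 ^ 2 + v.1 * v.2 + v.2 ^ 2) := by
      have k1 := Int.le_self_sq v.1
      have k2 := Int.le_self_sq v.2
      have k3 := Int.le_self_sq (v.1 + v.2)
      have k4 := Int.le_self_sq (-v.2)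
      rcases abs_cases v.2 with ⟨e, _⟩ | ⟨e, _⟩ <;> rw [e] <;> nlinarith
    have k' : 2 * (v.1 : ℝ) + v.2 + |(v.2 : ℝ)| ≤ 2 * (v.1 ^ 2 + v.1 * v.2 + v.2 ^ 2) := by
      exact_mod_cast k
    simp only [lnorm]
    push_cast at h ⊢
    have h1 : (zeta 1).im ≤ 1 := by nlinarith
    nlinarith [abs_nonneg (v.2 : ℝ)]

lemma abs_le_one_of_lnorm_eq_one (hc : c = 0 ∨ c = 1) {u : ℤ × ℤ} (hu : lnorm c u = 1) :
    |u.1| ≤ 1 ∧ |u.2| ≤ 1 := by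
  rw [← sq_le_one_iff_abs_le_one, ← sq_le_one_iff_abs_le_one]
  simp only [lnorm] at hu
  rcases hc with rfl | rfl
  · constructor <;> nlinarith [sq_nonneg u.1, sq_nonneg u.2]
  · have h1 : 3 * u.1 ^ 2 ≤ 4 := by nlinarith [sq_nonneg (u.1 + 2 * u.2)]
    have h2 : 3 * u.2 ^ 2 ≤ 4 := by nlinarith [sq_nonneg (2 * u.1 + u.2)]
    constructor <;> omega

/-- In both lattices distinct unit vectors are at least 60 degrees apart. -/
lemma emb_re_le_half (hc : c = 0 ∨ c = 1) {u : ℤ × ℤ} (hu : lnorm c u = 1) (h1 : u ≠ (1, 0)) :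
    (emb c u).re ≤ 1 / 2 := by
  obtain ⟨x, y⟩ := u
  have hb := abs_le_one_of_lnorm_eq_one hc hu
  obtain ⟨⟨a1, a2⟩, b1, b2⟩ := And.imp abs_le.1 abs_le.1 hb
  rw [emb_re]
  simp only [lnorm] at hu a1 a2 b1 b2 ⊢
  rcases hc with rfl | rfl <;> interval_cases x <;> interval_cases y <;> simp_all <;> norm_num

end lattice

/-! ### Meshes of bent edges -/

/-- The vectors that can have length one in the square or the hexagonal lattice. -/
def latticeUnits : Finset (ℤ × ℤ) := {(1, 0), (0, 1), (-1, 1), (-1, 0), (0, -1), (1, -1)}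

/-- A periodic set of unit edges of the square or hexagonal lattice, each of which is bent to one
of its sides. The bend at the vertex `v` in direction `u` is `1` (to the left), `-1` (to the right)
or `0` (no edge). -/
structure Mesh where
  c : ℤ
  hc : c = 0 ∨ c = 1
  M : ℕ
  M_pos : 0 < M
  bend : ℤ × ℤ → ℤ × ℤ → ℤ
  bend_periodic : ∀ v w u : ℤ × ℤ, bend (v.1 + M * w.1, v.2 + M * w.2) u = bend v u
  bend_sign : ∀ v u, bend v u = 0 ∨ bend v u = 1 ∨ bend v u = -1
  unit_of_bend : ∀ v u, bend v u ≠ 0 → u ∈ latticeUnits ∧ lnorm c u = 1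
  bend_mate : ∀ v u, bend (v + u) (-u) = -bend v u
  -- The last three conditions are a simple certificate of connectedness: row `0` and column `0` are
  -- complete, and every half-edge starts on a translate of column `0` or on a complete row.
  row_zero : ∀ x, bend (x, 0) (1, 0) ≠ 0
  column_zero : ∀ y, bend (0, y) (0, 1) ≠ 0
  row : ∀ v u, bend v u ≠ 0 → (M : ℤ) ∣ v.1 ∨ ∀ x, bend (x, v.2) (1, 0) ≠ 0

namespace Mesh

variable (m : Mesh)

/-! ### Half-edges as indices of the tiles -/

/-- The tiles in a unit cell, as half-edges. -/
abbrev HalfEdge : Type :=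
  {k : (Fin m.M × Fin m.M) × latticeUnits // m.bend (k.1.1, k.1.2) k.2 ≠ 0}

/-- The number of tiles in a unit cell. -/
def size : ℕ := Fintype.card m.HalfEdge

/-- The half-edge with a given number. -/
noncomputable def halfEdge (k : Fin m.size) : m.HalfEdge := (Fintype.equivFin m.HalfEdge).symm k

/-- The vertex of a half-edge in the unit cell. -/
noncomputable def base (k : Fin m.size) : ℤ × ℤ :=
  ((m.halfEdge k).1.1.1, (m.halfEdge k).1.1.2)

/-- The direction of a half-edge. -/
noncomputable def dir (k : Fin m.size) : ℤ × ℤ := (m.halfEdge k).1.2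

/-- The vertex of a half-edge. -/
noncomputable def vert (i : Fin m.size × (ℤ × ℤ)) : ℤ × ℤ :=
  ((m.base i.1).1 + m.M * i.2.1, (m.base i.1).2 + m.M * i.2.2)

lemma bend_base_ne_zero (k : Fin m.size) : m.bend (m.base k) (m.dir k) ≠ 0 := (m.halfEdge k).2

lemma bend_vert (i : Fin m.size × (ℤ × ℤ)) (u : ℤ × ℤ) :
    m.bend (m.vert i) u = m.bend (m.base i.1) u := m.bend_periodic _ _ _

lemma bend_vert_dir_ne_zero (i : Fin m.size × (ℤ × ℤ)) :
    m.bend (m.vert i) (m.dir i.1) ≠ 0 := by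
  rw [m.bend_vert]; exact m.bend_base_ne_zero _

lemma lnorm_dir (k : Fin m.size) : lnorm m.c (m.dir k) = 1 :=
  (m.unit_of_bend _ _ (m.bend_base_ne_zero k)).2

lemma vert_zero (k : Fin m.size) : m.vert (k, 0) = m.base k := by simp [vert]


lemma eq_of_base_eq_of_dir_eq {k l : Fin m.size} (hb : m.base k = m.base l)
    (hd : m.dir k = m.dir l) : k = l := by
  apply (Fintype.equivFin m.HalfEdge).symm.injective
  change m.halfEdge k = m.halfEdge l
  simp only [base, dir, Prod.mk.injEq, Nat.cast_inj] at hb hd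
  apply Subtype.ext
  refine Prod.ext (Prod.ext (Fin.ext hb.1) (Fin.ext hb.2)) (Subtype.ext hd)

lemma base_eq_of_vert_eq {i j : Fin m.size × (ℤ × ℤ)} (h : m.vert i = m.vert j) :
    m.base i.1 = m.base j.1 ∧ i.2 = j.2 := by
  have key : ∀ (a b : Fin m.M) (s t : ℤ), (a : ℤ) + m.M * s = b + m.M * t → a = b ∧ s = t := by
    intro a b s t hab
    have hM : (0 : ℤ) < m.M := by exact_mod_cast m.M_pos
    have h1 : ((a : ℤ) + m.M * s) % m.M = (b + m.M * t) % m.M := by rw [hab]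
    rw [Int.add_mul_emod_self_left, Int.add_mul_emod_self_left,
      Int.emod_eq_of_lt (by positivity) (by exact_mod_cast a.2),
      Int.emod_eq_of_lt (by positivity) (by exact_mod_cast b.2)] at h1
    refine ⟨Fin.ext (by exact_mod_cast h1), ?_⟩
    rw [h1] at hab
    exact mul_left_cancel₀ hM.ne' (by linarith)
  simp only [vert, base, Prod.mk.injEq] at h
  obtain ⟨h1, h2⟩ := key _ _ _ _ h.1
  obtain ⟨h3, h4⟩ := key _ _ _ _ h.2
  exact ⟨by simp [base, h1, h3], Prod.ext h2 h4⟩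

lemma eq_of_vert_eq_of_dir_eq {i j : Fin m.size × (ℤ × ℤ)} (h : m.vert i = m.vert j)
    (hd : m.dir i.1 = m.dir j.1) : i = j := by
  obtain ⟨h1, h2⟩ := m.base_eq_of_vert_eq h
  exact Prod.ext (m.eq_of_base_eq_of_dir_eq h1 hd) h2

lemma exists_index {v u : ℤ × ℤ} (h : m.bend v u ≠ 0) : ∃ i, m.vert i = v ∧ m.dir i.1 = u := by
  have hM : (0 : ℤ) < m.M := by exact_mod_cast m.M_pos
  have hr : ∀ x : ℤ, ∃ a : Fin m.M, (a : ℤ) = x % m.M := by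
    intro x
    have h0 := Int.emod_nonneg x hM.ne'
    refine ⟨⟨(x % m.M).toNat, ?_⟩, by simp [h0]⟩
    have := Int.emod_lt_of_pos x hM
    omega
  obtain ⟨a, ha⟩ := hr v.1
  obtain ⟨b, hb⟩ := hr v.2
  have hv : v = (a + m.M * (v.1 / m.M), b + m.M * (v.2 / m.M)) := by
    rw [ha, hb, Int.emod_add_mul_ediv, Int.emod_add_mul_ediv]
  have hab : m.bend (a, b) u ≠ 0 := by
    rw [hv] at h
    rwa [← m.bend_periodic (a, b) (v.1 / m.M, v.2 / m.M) u]
  refine ⟨(Fintype.equivFin m.HalfEdge ⟨((a, b), ⟨u, (m.unit_of_bend _ _ h).1⟩), hab⟩,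
    (v.1 / m.M, v.2 / m.M)), ?_, ?_⟩
  · conv_rhs => rw [hv]
    simp [vert, base, halfEdge]
  · simp [dir, halfEdge]

lemma exists_mate (k : Fin m.size) : ∃ i, m.vert i = m.base k + m.dir k ∧
    m.dir i.1 = -m.dir k := by
  apply m.exists_index
  rw [m.bend_mate]
  exact neg_ne_zero.2 (m.bend_base_ne_zero k)

/-- The other half of an edge. -/
noncomputable def mate (k : Fin m.size) : Fin m.size × (ℤ × ℤ) := (m.exists_mate k).choose

lemma vert_mate (k : Fin m.size) : m.vert (m.mate k) = m.base k + m.dir k :=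
  (m.exists_mate k).choose_spec.1

lemma dir_mate (k : Fin m.size) : m.dir (m.mate k).1 = -m.dir k :=
  (m.exists_mate k).choose_spec.2

lemma dir_ne_zero (k : Fin m.size) : m.dir k ≠ 0 := by
  intro h
  have := m.lnorm_dir k
  rw [h] at this
  simp [lnorm] at this

/-- Left and right are exchanged when an edge is seen from its other end. So exactly one half of
each edge has bend `1`, and listing the hinge from that half records it once. -/
lemma bend_mate_base (k : Fin m.size) :
    m.bend (m.base (m.mate k).1) (m.dir (m.mate k).1) = -m.bend (m.base k) (m.dir k) := by
  rw [← m.bend_vert, m.vert_mate, m.dir_mate, m.bend_mate]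

/-! ### The kirigami pattern -/

/-- Tiles at a common vertex are hinged there, and so are the two halves of every edge. -/
noncomputable def bonds : Finset (Fin m.size × Fin m.size × (ℤ × ℤ)) :=
  (Finset.univ.filter fun p : Fin m.size × Fin m.size =>
    p.1 < p.2 ∧ m.base p.1 = m.base p.2).image (fun p => (p.1, p.2, 0)) ∪
  (Finset.univ.filter fun k => m.bend (m.base k) (m.dir k) = 1).image fun k => (k, m.mate k)

lemma mem_bonds {k l : Fin m.size} {d : ℤ × ℤ} : (k, l, d) ∈ m.bonds ↔
    (k < l ∧ m.base k = m.base l ∧ d = 0) ∨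
      (m.bend (m.base k) (m.dir k) = 1 ∧ m.mate k = (l, d)) := by
  simp only [bonds, Finset.mem_union, Finset.mem_image, Finset.mem_filter, Finset.mem_univ,
    true_and, Prod.mk.injEq, Prod.exists]
  constructor
  · rintro (⟨a, b, ⟨h1, h2⟩, rfl, rfl, rfl⟩ | ⟨a, h1, rfl, h2⟩)
    · exact Or.inl ⟨h1, h2, rfl⟩
    · exact Or.inr ⟨h1, h2⟩
  · rintro (⟨h1, h2, rfl⟩ | ⟨h1, h2⟩)
    · exact Or.inl ⟨k, l, ⟨h1, h2⟩, rfl, rfl, rfl⟩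
    · exact Or.inr ⟨k, h1, rfl, h2⟩

open Classical in
/-- The position of a hinge on both tiles. -/
noncomputable def hingePoint (e : Fin m.size × Fin m.size × (ℤ × ℤ)) : ℂ :=
  if m.base e.1 = m.base e.2.1 ∧ e.2.2 = 0 then 0 else 1

lemma hingePoint_mem (e : Fin m.size × Fin m.size × (ℤ × ℤ)) : m.hingePoint e ∈ kite := by
  unfold hingePoint
  split_ifs
  · exact zero_mem_kite
  · exact one_mem_kite

/-- The ends of an edge are different vertices. Hence hinges at a vertex and hinges inside an edge
are never confused, which justifies the case distinction in `hingePoint`. -/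
lemma base_ne_of_mate_eq {k l : Fin m.size} (h : m.mate k = (l, 0)) : m.base k ≠ m.base l := by
  intro hb
  have h1 := m.vert_mate k
  rw [h, vert_zero, ← hb] at h1
  exact m.dir_ne_zero k (by simpa using h1)

/-- Bonds at a vertex are oriented by the order of the indices, bonds inside an edge by the sign of
the bend, so neither kind occurs in both directions. -/
lemma bonds_simple (k l : Fin m.size) (d : ℤ × ℤ) (h : (k, l, d) ∈ m.bonds) :
    (l, k, -d) ∉ m.bonds := by
  intro h'
  rw [mem_bonds] at h h'
  rcases h with ⟨h1, h2, rfl⟩ | ⟨h1, h2⟩ <;> rcases h' with ⟨h3, h4, h5⟩ | ⟨h3, h4⟩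
  · exact absurd h1 h3.not_gt
  · rw [neg_zero] at h4
    exact m.base_ne_of_mate_eq h4 h2.symm
  · rw [neg_eq_zero.1 h5] at h2
    exact m.base_ne_of_mate_eq h2 h4.symm
  · have := m.bend_mate_base k
    rw [h2, h1, h3] at this
    norm_num at this

/-! ### Connectedness -/

/-- The graph of hinged tiles. -/
noncomputable abbrev hingeGraph : SimpleGraph (Fin m.size × (ℤ × ℤ)) :=
  SimpleGraph.fromRel fun i j => (i.1, j.1, j.2 - i.2) ∈ m.bonds

lemma reachable_of_vert_eq {i j : Fin m.size × (ℤ × ℤ)} (h : m.vert i = m.vert j) :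
    m.hingeGraph.Reachable i j := by
  obtain ⟨h1, h2⟩ := m.base_eq_of_vert_eq h
  by_cases hij : i = j
  · rw [hij]
  apply SimpleGraph.Adj.reachable
  rw [SimpleGraph.fromRel_adj]
  refine ⟨hij, ?_⟩
  have hne : i.1 ≠ j.1 := fun h => hij (Prod.ext h h2)
  simp only [mem_bonds]
  rcases hne.lt_or_gt with h | h
  · exact Or.inl (Or.inl ⟨h, h1, by simp [h2]⟩)
  · exact Or.inr (Or.inl ⟨h, h1.symm, by simp [h2]⟩)

lemma reachable_mate {i j : Fin m.size × (ℤ × ℤ)} (h : m.vert j = m.vert i + m.dir i.1)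
    (hd : m.dir j.1 = -m.dir i.1) : m.hingeGraph.Reachable i j := by
  wlog hs : m.bend (m.base i.1) (m.dir i.1) = 1 generalizing i j
  · refine (this (i := j) (j := i) (by rw [h, hd]; simp) (by rw [hd]; simp) ?_).symm
    have h1 : m.bend (m.base i.1) (m.dir i.1) = -1 :=
      ((m.bend_sign _ _).resolve_left (m.bend_base_ne_zero i.1)).resolve_left hs
    rw [← bend_vert, h, hd, m.bend_mate, m.bend_vert, h1]; rfl
  have hj : m.mate i.1 = (j.1, j.2 - i.2) := by
    apply m.eq_of_vert_eq_of_dir_eq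
    · rw [m.vert_mate]
      have e1 := congrArg Prod.fst h
      have e2 := congrArg Prod.snd h
      simp only [vert, Prod.fst_add, Prod.snd_add] at e1 e2
      apply Prod.ext
      · simp only [vert, Prod.fst_add, Prod.fst_sub]; linarith
      · simp only [vert, Prod.snd_add, Prod.snd_sub]; linarith
    · rw [m.dir_mate, hd]
  apply SimpleGraph.Adj.reachable
  rw [SimpleGraph.fromRel_adj]
  refine ⟨fun hij => ?_, Or.inl (m.mem_bonds.2 (Or.inr ⟨hs, hj⟩))⟩
  rw [hij] at h
  exact m.dir_ne_zero j.1 (by simpa using h)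

/-- One step along the line crosses an edge to its other half and then changes tiles at the common
vertex. -/
lemma reachable_line {u : ℤ × ℤ} (f : ℤ → Fin m.size × (ℤ × ℤ)) (hd : ∀ x, m.dir (f x).1 = u)
    (hf : ∀ x, m.vert (f (x + 1)) = m.vert (f x) + u) (x : ℤ) :
    m.hingeGraph.Reachable (f x) (f 0) := by
  have step : ∀ x, m.hingeGraph.Reachable (f x) (f (x + 1)) := by
    intro x
    have hb : m.bend (m.vert (f x) + u) (-u) ≠ 0 := by
      rw [m.bend_mate, m.bend_vert, ← hd x]
      exact neg_ne_zero.2 (m.bend_base_ne_zero _)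
    obtain ⟨j, hj, hj'⟩ := m.exists_index hb
    refine (m.reachable_mate (i := f x) (j := j) (by rw [hj, hd]) (by rw [hj', hd])).trans ?_
    exact m.reachable_of_vert_eq (by rw [hj, hf])
  induction x using Int.induction_on with
  | zero => rfl
  | succ n ih => exact (step _).symm.trans ih
  | pred n ih =>
    have := step (-n - 1)
    rw [sub_add_cancel] at this
    exact this.trans ih

/-- From any tile walk along a complete column to row `0` and then to the origin, or along a
complete row to column `0` and then to the origin. -/
lemma hingeGraph_connected : m.hingeGraph.Connected := by
  choose f hf hf' using fun x => m.exists_index (m.row_zero x)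
  choose g hg hg' using fun y => m.exists_index (m.column_zero y)
  have key : ∀ i, m.hingeGraph.Reachable i (f 0) := by
    intro i
    rcases m.row _ _ (m.bend_vert_dir_ne_zero i) with ⟨t, ht⟩ | hrow
    · have hcol : ∀ y, m.bend ((m.vert i).1, y) (0, 1) ≠ 0 := by
        intro y
        have := m.bend_periodic (0, y) (t, 0) (0, 1)
        simp only [zero_add, mul_zero, add_zero] at this
        rw [ht, this]
        exact m.column_zero y
      choose q hq hq' using fun y => m.exists_index (hcol y)
      have h1 : m.hingeGraph.Reachable i (q (m.vert i).2) := m.reachable_of_vert_eq (by rw [hq])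
      have h2 := m.reachable_line q hq' (fun y => by rw [hq, hq]; simp) (m.vert i).2
      have h3 : m.hingeGraph.Reachable (q 0) (f (m.vert i).1) :=
        m.reachable_of_vert_eq (by rw [hq, hf])
      have h4 := m.reachable_line f hf' (fun y => by rw [hf, hf]; simp) (m.vert i).1
      exact h1.trans (h2.trans (h3.trans h4))
    · choose q hq hq' using fun x => m.exists_index (hrow x)
      have h1 : m.hingeGraph.Reachable i (q (m.vert i).1) := m.reachable_of_vert_eq (by rw [hq])
      have h2 := m.reachable_line q hq' (fun y => by rw [hq, hq]; simp) (m.vert i).1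
      have h3 : m.hingeGraph.Reachable (q 0) (g (m.vert i).2) :=
        m.reachable_of_vert_eq (by rw [hq, hg])
      have h4 := m.reachable_line g hg' (fun y => by rw [hg, hg]; simp) (m.vert i).2
      have h5 : m.hingeGraph.Reachable (g 0) (f 0) := m.reachable_of_vert_eq (by rw [hg, hf])
      exact h1.trans (h2.trans (h3.trans (h4.trans h5)))
  have : Nonempty (Fin m.size × (ℤ × ℤ)) := ⟨f 0⟩
  exact ⟨fun i j => (key i).trans (key j).symm⟩

/-- The kirigami pattern of a mesh: every edge consists of two hinged kites. -/
noncomputable def pattern : Pattern where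
  tile := kite
  isPolygonalTile := isPolygonalTile_kite
  n := m.size
  bonds := m.bonds
  src := m.hingePoint
  tgt := m.hingePoint
  src_mem e _ := m.hingePoint_mem e
  tgt_mem e _ := m.hingePoint_mem e
  simple := m.bonds_simple
  connected := m.hingeGraph_connected

/-! ### Its configurations -/

/-- The rotation part of a half-edge whose kites are bent by the angle `α`. -/
noncomputable def turn (α : ℝ) (v u : ℤ × ℤ) : ℂ := emb m.c u * Complex.exp (m.bend v u * α * I)

/-- The placement of the half-edge at `v` in direction `u`. -/
noncomputable def tileMap (α : ℝ) (v u : ℤ × ℤ) (z : ℂ) : ℂ :=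
  m.turn α v u * z + 2 * Real.cos α * emb m.c v

/-- The placement in which all kites are bent by the angle `α` away from the lattice edges. -/
noncomputable def placement (α : ℝ) : Placement m.size where
  rot k := Circle.exp ((emb m.c (m.dir k)).arg + m.bend (m.base k) (m.dir k) * α)
  pos k := 2 * Real.cos α * emb m.c (m.base k)
  a := 2 * Real.cos α * m.M
  b := 2 * Real.cos α * m.M * zeta m.c

lemma placement_map (α : ℝ) (i : Fin m.size × (ℤ × ℤ)) :
    (m.placement α).map i = m.tileMap α (m.vert i) (m.dir i.1) := by
  funext z
  have h1 : ‖emb m.c (m.dir i.1)‖ = 1 := (norm_emb_eq_one m.hc).2 (m.lnorm_dir _)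
  have h2 := Complex.norm_mul_exp_arg_mul_I (emb m.c (m.dir i.1))
  rw [h1, Complex.ofReal_one, one_mul] at h2
  simp only [Placement.map, placement, tileMap, turn, m.bend_vert, Circle.coe_exp]
  push_cast
  rw [add_mul, Complex.exp_add, h2]
  simp only [vert, emb]
  push_cast
  ring

lemma turn_mate (α : ℝ) (v u : ℤ × ℤ) :
    m.turn α (v + u) (-u) = -emb m.c u * Complex.exp (-(m.bend v u * α * I)) := by
  simp only [turn, m.bend_mate, emb_neg]
  push_cast
  ring_nf

lemma exp_add_exp_neg {s : ℤ} (hs : s = 1 ∨ s = -1) (α : ℝ) :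
    Complex.exp (s * α * I) + Complex.exp (-(s * α * I)) = 2 * Real.cos α := by
  rw [Complex.ofReal_cos, Complex.cos]
  rcases hs with rfl | rfl <;> push_cast <;> ring_nf

lemma bend_eq {v u : ℤ × ℤ} (h : m.bend v u ≠ 0) : m.bend v u = 1 ∨ m.bend v u = -1 :=
  (m.bend_sign v u).resolve_left h

/-- The two axes are the legs of an isosceles triangle with base angles `α`, whose base is `2 * cos
α`. This is why the lattice is scaled by that factor. -/
lemma tileMap_mate (α : ℝ) {v u : ℤ × ℤ} (h : m.bend v u ≠ 0) :
    m.tileMap α (v + u) (-u) 1 = m.tileMap α v u 1 := by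
  have := exp_add_exp_neg (m.bend_eq h) α
  simp only [tileMap, turn_mate, emb_add]
  rw [turn]
  linear_combination (-emb m.c u) * this

/-! ### Non-overlap -/

/-- Small bending angles. -/
def IsSmallAngle (α : ℝ) : Prop := 0 < Real.cos α ∧ |Real.sin α| ≤ Real.cos α / 4

/-- The half-edge at `v` in direction `u` stays in a sector of the Voronoi cell of `v`. -/
lemma tileMap_sub (α : ℝ) (hα : IsSmallAngle α) {v u : ℤ × ℤ} (h : m.bend v u ≠ 0) {z : ℂ}
    (hz : z ∈ m.tileMap α v u '' kite) :
    ∃ w : ℂ, z = emb m.c u * w + 2 * Real.cos α * emb m.c v ∧ 0 ≤ w.re ∧ w.re ≤ Real.cos α ∧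
      |w.im| ≤ w.re / 2 := by
  obtain ⟨t, ht, rfl⟩ := hz
  have he : Complex.exp (m.bend v u * α * I) = ⟨Real.cos α, m.bend v u * Real.sin α⟩ := by
    apply Complex.ext <;> rcases m.bend_eq h with h | h <;> rw [h] <;>
      simp [Complex.exp_re, Complex.exp_im]
  refine ⟨⟨Real.cos α, m.bend v u * Real.sin α⟩ * t, by simp only [tileMap, turn, he]; ring,
    turned_kite_bounds hα.1.le ?_ ht⟩
  rcases m.bend_eq h with h | h <;> rw [h] <;> simpa using hα.2

/-- Weak separation suffices: a common interior point, pushed slightly in the direction `μ`, would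
stay in `A` but violate its bound. -/
lemma disjoint_interior_of_separated {A B : Set ℂ} {μ : ℂ} (hμ : μ ≠ 0) {r : ℝ}
    (hA : ∀ z ∈ A, (z * conj μ).re ≤ r) (hB : ∀ z ∈ B, r ≤ (z * conj μ).re) :
    Disjoint (interior A) (interior B) := by
  rw [Set.disjoint_left]
  intro z hzA hzB
  have h1 : Filter.Tendsto (fun t : ℝ => z + t * μ) (nhdsWithin 0 (Set.Ioi 0)) (nhds z) := by
    have : Continuous fun t : ℝ => z + t * μ := by fun_prop
    have h := this.tendsto 0
    simp only [Complex.ofReal_zero, zero_mul, add_zero] at h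
    exact h.mono_left nhdsWithin_le_nhds
  obtain ⟨t, ht, ht0⟩ := ((h1.eventually (mem_interior_iff_mem_nhds.1 hzA)).and
    self_mem_nhdsWithin).exists
  have h2 := hA _ ht
  have h3 := hB _ (interior_subset hzB)
  rw [add_mul, mul_assoc, Complex.mul_conj, Complex.add_re] at h2
  have h4 : 0 < t * Complex.normSq μ := mul_pos ht0 (Complex.normSq_pos.2 hμ)
  rw [← Complex.ofReal_mul, Complex.ofReal_re] at h2
  linarith

lemma sector_le {e w : ℂ} (hw : |w.im| ≤ w.re / 2) :
    (w * conj e).re ≤ w.re * (e.re + |e.im| / 2) := by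
  have h : w.im * e.im ≤ w.re / 2 * |e.im| := by
    refine (le_abs_self _).trans ?_
    rw [abs_mul]
    exact mul_le_mul_of_nonneg_right hw (abs_nonneg _)
  simp only [Complex.mul_re, Complex.conj_re, Complex.conj_im]
  linarith

/-- The bound is the perpendicular bisector between `v` and `v + l` in the scaled lattice. Rotating
by the inverse of `u` puts the tile in the standard sector, where `re_add_half_abs_im_le` applies.
-/
lemma tile_in_voronoi (α : ℝ) (hα : IsSmallAngle α) {v u : ℤ × ℤ} (h : m.bend v u ≠ 0) {z : ℂ}
    (hz : z ∈ m.tileMap α v u '' kite) (l : ℤ × ℤ) :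
    ((z - 2 * Real.cos α * emb m.c v) * conj (emb m.c l)).re ≤
      Real.cos α * ‖emb m.c l‖ ^ 2 := by
  obtain ⟨w, rfl, h1, h2, h3⟩ := m.tileMap_sub α hα h hz
  have hu := unit_mul_conj m.hc (m.unit_of_bend _ _ h).2
  have hn := (norm_emb_eq_one m.hc).2 (m.unit_of_bend _ _ h).2
  have hs := sector_le (e := emb m.c (lmul m.c l (lconj m.c u))) h3
  have hb := re_add_half_abs_im_le m.hc (lmul m.c l (lconj m.c u))
  have hl : ‖emb m.c (lmul m.c l (lconj m.c u))‖ = ‖emb m.c l‖ := by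
    rw [emb_lmul m.hc, emb_lconj, norm_mul, RCLike.norm_conj, hn, mul_one]
  rw [hl] at hb
  have e1 : (emb m.c u * w + 2 * Real.cos α * emb m.c v - 2 * Real.cos α * emb m.c v) *
      conj (emb m.c l) = w * conj (emb m.c (lmul m.c l (lconj m.c u))) := by
    rw [emb_lmul m.hc, emb_lconj, map_mul, Complex.conj_conj]; ring
  rw [e1]
  calc _ ≤ _ := hs
    _ ≤ w.re * ‖emb m.c l‖ ^ 2 := mul_le_mul_of_nonneg_left hb h1
    _ ≤ _ := mul_le_mul_of_nonneg_right h2 (by positivity)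

lemma tile_in_sector (α : ℝ) (hα : IsSmallAngle α) {v u u' : ℤ × ℤ} (h : m.bend v u ≠ 0)
    (hu' : lnorm m.c u' = 1) (hne : u ≠ u') {z : ℂ} (hz : z ∈ m.tileMap α v u '' kite) :
    ((z - 2 * Real.cos α * emb m.c v) * conj (emb m.c u' - emb m.c u)).re ≤ 0 := by
  obtain ⟨w, rfl, h1, h2, h3⟩ := m.tileMap_sub α hα h hz
  have hn := (m.unit_of_bend _ _ h).2
  have hu := unit_mul_conj m.hc hn
  set e := lmul m.c u' (lconj m.c u) with he
  have he' : emb m.c e = emb m.c u' * conj (emb m.c u) := by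
    rw [he, emb_lmul m.hc, emb_lconj]
  have hn1 : ‖emb m.c e‖ = 1 := by
    rw [he', norm_mul, RCLike.norm_conj, (norm_emb_eq_one m.hc).2 hn,
      (norm_emb_eq_one m.hc).2 hu', mul_one]
  have he1 : e ≠ (1, 0) := by
    intro h10
    rw [h10, emb_one] at he'
    apply hne
    apply emb_injective m.hc
    linear_combination emb m.c u * he' + emb m.c u' * hu
  have hre := emb_re_le_half m.hc ((norm_emb_eq_one m.hc).1 hn1) he1
  have him : |(emb m.c e).im| ≤ 1 := hn1 ▸ Complex.abs_im_le_norm _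
  have hs := sector_le (e := emb m.c e) h3
  have e1 : (emb m.c u * w + 2 * Real.cos α * emb m.c v - 2 * Real.cos α * emb m.c v) *
      conj (emb m.c u' - emb m.c u) = w * conj (emb m.c e) - w := by
    rw [he', map_mul, Complex.conj_conj, map_sub]
    linear_combination (-w) * hu
  rw [e1, Complex.sub_re]
  -- With `e` the relative direction, the expression is at most `w.re * (e.re + |e.im| / 2 - 1)`,
  -- and `1/2 + 1/2 - 1 = 0`.
  nlinarith

/-- Tiles at one vertex are separated by the bisector of their lattice directions, tiles at
different vertices by the perpendicular bisector of the vertices. -/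
lemma disjoint_tiles (α : ℝ) (hα : IsSmallAngle α) {v u v' u' : ℤ × ℤ} (h : m.bend v u ≠ 0)
    (h' : m.bend v' u' ≠ 0) (hne : v = v' → u ≠ u') :
    Disjoint (interior (m.tileMap α v u '' kite)) (interior (m.tileMap α v' u' '' kite)) := by
  by_cases hv : v = v'
  · subst hv
    have hne := hne rfl
    refine disjoint_interior_of_separated (μ := emb m.c u' - emb m.c u)
      (sub_ne_zero.2 fun h => hne (emb_injective m.hc h).symm)
      (r := (2 * Real.cos α * emb m.c v * conj (emb m.c u' - emb m.c u)).re) ?_ ?_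
    · intro z hz
      have := m.tile_in_sector α hα h (m.unit_of_bend _ _ h').2 hne hz
      rw [sub_mul, Complex.sub_re] at this
      linarith
    · intro z hz
      have := m.tile_in_sector α hα h' (m.unit_of_bend _ _ h).2 hne.symm hz
      rw [← neg_sub (emb m.c u'), map_neg, mul_neg, Complex.neg_re, sub_mul, Complex.sub_re] at this
      linarith
  · have hl : emb m.c v' - emb m.c v ≠ 0 :=
      sub_ne_zero.2 fun h => hv (emb_injective m.hc h).symm
    have hd : ((2 * Real.cos α * emb m.c v' - 2 * Real.cos α * emb m.c v) *
        conj (emb m.c v' - emb m.c v)).re = 2 * Real.cos α * ‖emb m.c v' - emb m.c v‖ ^ 2 := by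
      rw [← mul_sub, mul_assoc, Complex.mul_conj, Complex.normSq_eq_norm_sq]
      exact_mod_cast rfl
    refine disjoint_interior_of_separated hl
      (r := (2 * Real.cos α * emb m.c v * conj (emb m.c v' - emb m.c v)).re +
        Real.cos α * ‖emb m.c v' - emb m.c v‖ ^ 2) ?_ ?_
    · intro z hz
      have := m.tile_in_voronoi α hα h hz (v' - v)
      rw [emb_sub, sub_mul, Complex.sub_re] at this
      linarith
    · intro z hz
      have := m.tile_in_voronoi α hα h' hz (v - v')
      rw [emb_sub, ← neg_sub (emb m.c v'), map_neg, mul_neg, Complex.neg_re, norm_neg, sub_mul,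
        Complex.sub_re] at this
      rw [sub_mul, Complex.sub_re] at hd
      linarith

/-! ### Cell area, configurations and deployment -/

lemma cellArea_placement (α : ℝ) :
    (m.placement α).cellArea = (Real.cos α) ^ 2 * (4 * m.M ^ 2 * (zeta m.c).im) := by
  have hz := zeta_im_pos m.hc
  have e : (conj (2 * (Real.cos α : ℂ) * m.M) * (2 * Real.cos α * m.M * zeta m.c)).im =
      Real.cos α ^ 2 * (4 * m.M ^ 2 * (zeta m.c).im) := by
    have : conj (2 * (Real.cos α : ℂ) * m.M) * (2 * Real.cos α * m.M * zeta m.c) =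
        ((Real.cos α ^ 2 * (4 * m.M ^ 2) : ℝ) : ℂ) * zeta m.c := by
      simp only [map_mul, Complex.conj_ofReal, map_natCast, map_ofNat]
      push_cast
      ring
    rw [this, Complex.im_ofReal_mul]
    ring
  simp only [Placement.cellArea, placement]
  rw [e, abs_of_nonneg (by positivity)]

lemma disjoint_placement (α : ℝ) (hα : IsSmallAngle α) {i j : Fin m.size × (ℤ × ℤ)}
    (hij : i ≠ j) : Disjoint (interior ((m.placement α).map i '' kite))
      (interior ((m.placement α).map j '' kite)) := by
  rw [placement_map, placement_map]
  refine m.disjoint_tiles α hα (m.bend_vert_dir_ne_zero i) (m.bend_vert_dir_ne_zero j)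
    fun hv hu => hij (m.eq_of_vert_eq_of_dir_eq hv hu)

lemma hinge_placement (α : ℝ) {k l : Fin m.size} {d : ℤ × ℤ} (h : (k, l, d) ∈ m.bonds) :
    (m.placement α).map (k, 0) (m.hingePoint (k, l, d)) =
      (m.placement α).map (l, d) (m.hingePoint (k, l, d)) := by
  rw [placement_map, placement_map]
  rcases m.mem_bonds.1 h with ⟨-, hb, rfl⟩ | ⟨-, hb⟩
  · have : m.hingePoint (k, l, 0) = 0 := if_pos ⟨hb, rfl⟩
    rw [this, m.vert_zero, m.vert_zero, hb]
    simp [tileMap]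
  · have : m.hingePoint (k, l, d) = 1 := by
      refine if_neg ?_
      rintro ⟨h1, h2⟩
      change d = 0 at h2
      subst h2
      exact m.base_ne_of_mate_eq hb h1
    rw [this, ← hb, m.vert_mate, m.dir_mate, m.vert_zero,
      m.tileMap_mate α (m.bend_base_ne_zero k)]

lemma cellArea_pos (α : ℝ) (hα : IsSmallAngle α) : 0 < (m.placement α).cellArea := by
  rw [cellArea_placement]
  have := m.M_pos
  have := zeta_im_pos m.hc
  have := hα.1
  positivity

lemma isConfiguration (α : ℝ) (hα : IsSmallAngle α) :
    m.pattern.IsConfiguration (m.placement α) where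
  periods := m.cellArea_pos α hα
  disjoint _ _ hij := m.disjoint_placement α hα hij
  hinge _ _ _ h := m.hinge_placement α h

lemma isSmallAngle_of_mem {α : ℝ} (h : α ∈ Set.Icc 0 (Real.arctan (1 / 4))) :
    IsSmallAngle α := by
  have h2 := Real.arctan_lt_pi_div_two (1 / 4)
  have hcos : 0 < Real.cos α :=
    Real.cos_pos_of_mem_Ioo ⟨by linarith [h.1, Real.pi_pos], by linarith [h.2]⟩
  refine ⟨hcos, ?_⟩
  have hsin : 0 ≤ Real.sin α :=
    Real.sin_nonneg_of_nonneg_of_le_pi h.1 (by linarith [h.2, Real.pi_pos])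
  rw [abs_of_nonneg hsin]
  have ht : Real.tan α ≤ 1 / 4 := by
    rw [← Real.arctan_le_arctan_iff,
      Real.arctan_tan (by linarith [h.1, Real.pi_pos]) (by linarith [h.2])]
    exact h.2
  rw [Real.tan_eq_sin_div_cos, div_le_iff₀ hcos] at ht
  linarith

/-- The bending angle of the initial configuration. -/
noncomputable def initialAngle : ℝ := Real.arctan (1 / 4)

lemma initialAngle_pos : 0 < initialAngle := Real.arctan_pos.2 (by norm_num)

/-- The factor `1 - 1` is the value at `t = 1` of the factor `1 - t` in the unbending path, where
the angle is zero. -/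
lemma cellArea_initial_lt : (m.placement initialAngle).cellArea <
    (m.placement ((1 - 1) * initialAngle)).cellArea := by
  have hp := initialAngle_pos
  rw [cellArea_placement, cellArea_placement]
  have h1 := m.M_pos
  have h2 := zeta_im_pos m.hc
  apply mul_lt_mul_of_pos_right _ (by positivity)
  have h3 : 0 < Real.sin initialAngle := Real.sin_pos_of_pos_of_lt_pi hp
    ((Real.arctan_lt_pi_div_two _).trans (by linarith [Real.pi_pos]))
  have h4 := Real.sin_sq_add_cos_sq initialAngle
  simp only [sub_self, zero_mul, Real.cos_zero]
  nlinarith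

lemma isDeployable : m.pattern.IsDeployable (m.placement initialAngle) := by
  have hp := initialAngle_pos
  refine ⟨fun t => m.placement ((1 - t) * initialAngle), ?_, fun k => ?_, fun k => ?_, ?_, ?_,
    fun t ht => m.isConfiguration _ (isSmallAngle_of_mem ⟨?_, ?_⟩),
    m.cellArea_initial_lt⟩
  · change m.placement _ = m.placement _
    rw [sub_zero, one_mul]
  · apply Continuous.continuousOn
    simp only [placement]
    fun_prop
  · apply Continuous.continuousOn
    simp only [placement]
    fun_prop
  · apply Continuous.continuousOn
    simp only [placement]
    fun_prop
  · apply Continuous.continuousOn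
    simp only [placement]
    fun_prop
  · exact mul_nonneg (by linarith [ht.2]) hp.le
  · change _ ≤ initialAngle
    nlinarith [ht.1]

end Mesh

/-! ### Isometries of the lattice -/

/-- Complex conjugation, if `f` is true. -/
noncomputable def flip (f : Bool) (z : ℂ) : ℂ := if f then conj z else z

/-- Complex conjugation in lattice coordinates, if `f` is true. -/
def lflip (c : ℤ) (f : Bool) (v : ℤ × ℤ) : ℤ × ℤ := if f then lconj c v else v

/-- The effect of `flip` on orientations. -/
def flipSign (f : Bool) : ℤ := if f then -1 else 1

section flip

variable {c : ℤ}

lemma emb_lflip (f : Bool) (v : ℤ × ℤ) : emb c (lflip c f v) = flip f (emb c v) := by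
  cases f <;> simp [lflip, flip, emb_lconj]

lemma flip_mul (f : Bool) (z w : ℂ) : flip f (z * w) = flip f z * flip f w := by
  cases f <;> simp [flip]

lemma flip_add (f : Bool) (z w : ℂ) : flip f (z + w) = flip f z + flip f w := by
  cases f <;> simp [flip]

lemma flip_ofReal (f : Bool) (r : ℝ) : flip f r = r := by
  cases f <;> simp [flip]

lemma flip_two (f : Bool) : flip f 2 = 2 := by
  cases f
  · rfl
  · exact map_ofNat _ 2

lemma flip_two_mul_ofReal_mul (f : Bool) (r : ℝ) (z : ℂ) :
    flip f (2 * r * z) = 2 * r * flip f z := by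
  rw [flip_mul, flip_mul, flip_two, flip_ofReal]

@[simp] lemma flip_flip (f : Bool) (z : ℂ) : flip f (flip f z) = z := by
  cases f <;> simp [flip]

lemma flip_injective (f : Bool) : Function.Injective (flip f) :=
  Function.LeftInverse.injective (flip_flip f)

lemma flip_exp (f : Bool) (s : ℤ) (α : ℝ) :
    flip f (Complex.exp (s * α * I)) = Complex.exp ((flipSign f * s : ℤ) * α * I) := by
  cases f
  · simp [flip, flipSign]
  · simp [flip, flipSign, ← Complex.exp_conj]

/-- Since the kite is symmetric in its axis, reflections can map tiles to tiles although tiles are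
placed by direct isometries only. -/
lemma flip_image_kite (f : Bool) : flip f '' kite = kite := by
  cases f
  · have h : flip false = id := by ext z; simp [flip]
    rw [h, Set.image_id]
  · have h : flip true = (Complex.conjAe.toLinearMap : ℂ → ℂ) := by ext z; simp [flip]
    rw [h, kite, LinearMap.image_convexHull]
    congr 1
    have h1 : conj (⟨1 / 4, 1 / 24⟩ : ℂ) = ⟨1 / 4, -1 / 24⟩ := by
      apply Complex.ext <;> simp; norm_num
    have h2 : conj (⟨1 / 4, -1 / 24⟩ : ℂ) = ⟨1 / 4, 1 / 24⟩ := by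
      rw [← h1, Complex.conj_conj]
    simp only [kiteVertices, Finset.coe_insert, Finset.coe_singleton, Set.image_insert_eq,
      Set.image_singleton, AlgEquiv.toLinearMap_apply, Complex.conjAe_coe, map_zero, map_one, h1,
      h2]
    rw [Set.pair_comm]

lemma lnorm_lmul (hc : c = 0 ∨ c = 1) {u v : ℤ × ℤ} (hu : lnorm c u = 1) (hv : lnorm c v = 1) :
    lnorm c (lmul c u v) = 1 := by
  rw [← norm_emb_eq_one hc] at *
  rw [emb_lmul hc, norm_mul, hu, hv, one_mul]

lemma lnorm_lconj (hc : c = 0 ∨ c = 1) {u : ℤ × ℤ} (hu : lnorm c u = 1) :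
    lnorm c (lconj c u) = 1 := by
  rw [← norm_emb_eq_one hc] at *
  rw [emb_lconj, RCLike.norm_conj, hu]

lemma lnorm_lflip (hc : c = 0 ∨ c = 1) (f : Bool) {u : ℤ × ℤ} (hu : lnorm c u = 1) :
    lnorm c (lflip c f u) = 1 := by
  cases f
  · exact hu
  · exact lnorm_lconj hc hu

lemma emb_ne_zero (hc : c = 0 ∨ c = 1) {u : ℤ × ℤ} (hu : lnorm c u = 1) : emb c u ≠ 0 := by
  rw [← norm_pos_iff, (norm_emb_eq_one hc).2 hu]
  exact one_pos

end flip

lemma exists_isometry (f : Bool) {u : ℂ} (hu : ‖u‖ = 1) (t : ℂ) :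
    ∃ g : ℂ ≃ᵢ ℂ, ∀ z, g z = u * flip f z + t := by
  let a : Circle := ⟨u, by simp [Submonoid.unitSphere, hu]⟩
  refine ⟨((if f then conjLIE else LinearIsometryEquiv.refl ℝ ℂ).trans
    (rotation a)).toIsometryEquiv.trans (IsometryEquiv.addRight t), fun z => ?_⟩
  cases f
  · change (a : ℂ) * z + t = _
    rfl
  · change (a : ℂ) * conj z + t = _
    rfl

lemma isometry_eq (g : ℂ ≃ᵢ ℂ) : ∃ (f : Bool) (u : ℂ), ∀ z, g z = u * flip f z + g 0 := by
  have h : ∀ z, g z = g.toRealAffineIsometryEquiv.linearIsometryEquiv z + g 0 := by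
    intro z
    have := g.toRealAffineIsometryEquiv.map_vadd 0 z
    simpa using this
  obtain ⟨a, ha | ha⟩ := linear_isometry_complex g.toRealAffineIsometryEquiv.linearIsometryEquiv
  · exact ⟨false, a, fun z => by rw [h z, ha, rotation_apply]; rfl⟩
  · exact ⟨true, a, fun z => by rw [h z, ha]; simp [flip]⟩

/-! ### Symmetries of the configuration as symmetries of the mesh -/

namespace Mesh

variable (m : Mesh)

/-- The lattice isometry `z ↦ τ * z + w` (or `z ↦ τ * conj z + w`) preserves the mesh. -/
def IsSymmetry (f : Bool) (τ w : ℤ × ℤ) : Prop :=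
  ∀ v u, lnorm m.c u = 1 →
    m.bend (lmul m.c τ (lflip m.c f v) + w) (lmul m.c τ (lflip m.c f u)) = flipSign f * m.bend v u

lemma mem_tiles {α : ℝ} {S : Set ℂ} : S ∈ m.pattern.tiles (m.placement α) ↔
    ∃ v u, m.bend v u ≠ 0 ∧ S = m.tileMap α v u '' kite := by
  constructor
  · rintro ⟨i, rfl⟩
    refine ⟨m.vert i, m.dir i.1, m.bend_vert_dir_ne_zero i,
      congrArg (· '' kite) (m.placement_map α i)⟩
  · rintro ⟨v, u, h, rfl⟩
    obtain ⟨i, rfl, rfl⟩ := m.exists_index h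
    exact ⟨i, congrArg (· '' kite) (m.placement_map α i)⟩

lemma norm_turn (α : ℝ) {v u : ℤ × ℤ} (h : m.bend v u ≠ 0) : ‖m.turn α v u‖ = 1 := by
  rw [turn, norm_mul, (norm_emb_eq_one m.hc).2 (m.unit_of_bend _ _ h).2, one_mul]
  exact_mod_cast Complex.norm_exp_ofReal_mul_I _

lemma isometry_tileMap (α : ℝ) {v u : ℤ × ℤ} (h : m.bend v u ≠ 0) :
    Isometry (m.tileMap α v u) := by
  apply Isometry.of_dist_eq
  intro z w
  simp only [tileMap, dist_eq_norm]
  rw [add_sub_add_right_eq_sub, ← mul_sub, norm_mul, m.norm_turn α h, one_mul]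

lemma tileMap_zero (α : ℝ) (v u : ℤ × ℤ) : m.tileMap α v u 0 = 2 * Real.cos α * emb m.c v := by
  simp [tileMap]

lemma tileMap_one (α : ℝ) (v u : ℤ × ℤ) :
    m.tileMap α v u 1 = m.turn α v u + 2 * Real.cos α * emb m.c v := by
  simp [tileMap]

lemma exists_tile_of_mem_symmetryGroup {α : ℝ} {g : ℂ ≃ᵢ ℂ}
    (hg : g ∈ symmetryGroup (m.pattern.tiles (m.placement α))) {v u : ℤ × ℤ}
    (h : m.bend v u ≠ 0) : ∃ v' u', m.bend v' u' ≠ 0 ∧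
      g (m.tileMap α v u 0) = m.tileMap α v' u' 0 ∧
      g (m.tileMap α v u 1) = m.tileMap α v' u' 1 := by
  obtain ⟨v', u', h', e⟩ := m.mem_tiles.1 ((hg _).2 (m.mem_tiles.2 ⟨v, u, h, rfl⟩))
  rw [← Set.image_comp] at e
  exact ⟨v', u', h', ends_eq_of_image_kite_eq (g.isometry.comp (m.isometry_tileMap α h))
    (m.isometry_tileMap α h') e⟩

lemma cos_initialAngle_pos : 0 < Real.cos initialAngle :=
  (isSmallAngle_of_mem ⟨initialAngle_pos.le, le_refl _⟩).1

lemma two_cos_ne_zero : (2 * Real.cos initialAngle : ℂ) ≠ 0 := by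
  exact_mod_cast (mul_pos two_pos cos_initialAngle_pos).ne'

lemma sin_initialAngle_pos : 0 < Real.sin initialAngle :=
  Real.sin_pos_of_pos_of_lt_pi initialAngle_pos
    ((Real.arctan_lt_pi_div_two _).trans (by linarith [Real.pi_pos]))

/-- A bent direction determines both the lattice direction and the bend. -/
lemma eq_of_emb_mul_exp_eq {c : ℤ} (hc : c = 0 ∨ c = 1) {p q : ℤ × ℤ} (hp : lnorm c p = 1)
    (hq : lnorm c q = 1) {s t : ℤ} (hs : s = 1 ∨ s = -1) (ht : t = 1 ∨ t = -1)
    (h : emb c p * Complex.exp (s * initialAngle * I) =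
      emb c q * Complex.exp (t * initialAngle * I)) : p = q ∧ s = t := by
  by_cases hst : s = t
  · subst hst
    exact ⟨emb_injective hc (mul_right_cancel₀ (Complex.exp_ne_zero _) h), rfl⟩
  -- With opposite bends the two lattice directions would differ by the angle `2 * initialAngle`,
  -- which is neither zero nor as large as 60 degrees.
  exfalso
  have hts : t = -s := by omega
  subst hts
  have he : emb c (lmul c p (lconj c q)) = Complex.exp ((-2 * s * initialAngle : ℝ) * I) := by
    have h1 := unit_mul_conj hc hq
    have h2 : Complex.exp (s * initialAngle * I) *
        Complex.exp ((-s : ℤ) * initialAngle * I) = 1 := by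
      rw [← Complex.exp_add]; push_cast; simp
    have h3 : Complex.exp ((-2 * s * initialAngle : ℝ) * I) =
        Complex.exp ((-s : ℤ) * initialAngle * I) * Complex.exp ((-s : ℤ) * initialAngle * I) := by
      rw [← Complex.exp_add]; push_cast; ring_nf
    rw [h3, emb_lmul hc, emb_lconj]
    linear_combination conj (emb c q) * Complex.exp ((-s : ℤ) * initialAngle * I) * h
      + Complex.exp ((-s : ℤ) * initialAngle * I) * Complex.exp ((-s : ℤ) * initialAngle * I) * h1
      - emb c p * conj (emb c q) * h2
  have hsin := sin_initialAngle_pos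
  obtain ⟨hcos, hsmall⟩ := isSmallAngle_of_mem ⟨initialAngle_pos.le, le_refl _⟩
  rw [abs_of_pos hsin] at hsmall
  have hsc := Real.sin_sq_add_cos_sq initialAngle
  have hre : (emb c (lmul c p (lconj c q))).re = Real.cos (2 * initialAngle) := by
    rw [he, Complex.exp_ofReal_mul_I_re]
    rcases hs with rfl | rfl
    · rw [← Real.cos_neg]; push_cast; ring_nf
    · push_cast; ring_nf
  rw [Real.cos_two_mul] at hre
  have h10 : lmul c p (lconj c q) = (1, 0) := by
    by_contra hne
    have := emb_re_le_half hc (lnorm_lmul hc hp (lnorm_lconj hc hq)) hne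
    rw [hre] at this
    nlinarith
  rw [h10, emb_one, Complex.one_re] at hre
  nlinarith

section symmetry

variable {g : ℂ ≃ᵢ ℂ} {f : Bool} {τ w : ℤ × ℤ}

/-- The image of the end `0` gives the vertex; the image of the axis vector gives direction and bend
by `eq_of_emb_mul_exp_eq`. -/
lemma eq_of_tile_mapsTo (hτ : lnorm m.c τ = 1)
    (hg : ∀ z, g z = emb m.c τ * flip f z + 2 * Real.cos initialAngle * emb m.c w)
    {v u v' u' : ℤ × ℤ} (h : m.bend v u ≠ 0) (h' : m.bend v' u' ≠ 0)
    (h0 : g (m.tileMap initialAngle v u 0) = m.tileMap initialAngle v' u' 0)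
    (h1 : g (m.tileMap initialAngle v u 1) = m.tileMap initialAngle v' u' 1) :
    v' = lmul m.c τ (lflip m.c f v) + w ∧ u' = lmul m.c τ (lflip m.c f u) ∧
      m.bend v' u' = flipSign f * m.bend v u := by
  rw [tileMap_zero, tileMap_zero, hg, flip_two_mul_ofReal_mul] at h0
  have hv : v' = lmul m.c τ (lflip m.c f v) + w := by
    apply emb_injective m.hc
    apply mul_left_cancel₀ two_cos_ne_zero
    rw [← h0, emb_add, emb_lmul m.hc, emb_lflip]
    ring
  rw [tileMap_one, tileMap_one, hg, flip_add, flip_two_mul_ofReal_mul] at h1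
  have ht : m.turn initialAngle v' u' = emb m.c τ * flip f (m.turn initialAngle v u) := by
    linear_combination h0 - h1
  rw [turn, turn, flip_mul, flip_exp, ← emb_lflip, ← mul_assoc, ← emb_lmul m.hc] at ht
  have hs : flipSign f * m.bend v u = 1 ∨ flipSign f * m.bend v u = -1 := by
    rcases m.bend_eq h with h | h <;> cases f <;> simp [h, flipSign]
  exact ⟨hv, eq_of_emb_mul_exp_eq m.hc (m.unit_of_bend _ _ h').2
    (lnorm_lmul m.hc hτ (lnorm_lflip m.hc f (m.unit_of_bend _ _ h).2)) (m.bend_eq h') hs ht⟩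

lemma lmul_lflip_injective (hτ : lnorm m.c τ = 1) {v v' : ℤ × ℤ}
    (h : lmul m.c τ (lflip m.c f v) = lmul m.c τ (lflip m.c f v')) : v = v' := by
  have h1 := congrArg (emb m.c) h
  rw [emb_lmul m.hc, emb_lmul m.hc, emb_lflip, emb_lflip] at h1
  exact emb_injective m.hc (flip_injective f (mul_left_cancel₀ (emb_ne_zero m.hc hτ) h1))

lemma isSymmetry_of_mem (hτ : lnorm m.c τ = 1)
    (hg : ∀ z, g z = emb m.c τ * flip f z + 2 * Real.cos initialAngle * emb m.c w)
    (hmem : g ∈ symmetryGroup (m.pattern.tiles (m.placement initialAngle))) :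
    m.IsSymmetry f τ w := by
  intro v u _
  by_cases h : m.bend v u = 0
  · rw [h, mul_zero]
    -- A missing edge must stay missing: an edge in its image would be pulled back by the inverse
    -- symmetry.
    by_contra h'
    obtain ⟨v₁, u₁, h₁, e0, e1⟩ := m.exists_tile_of_mem_symmetryGroup (inv_mem hmem) h'
    have e0' := congrArg g e0
    have e1' := congrArg g e1
    rw [IsometryEquiv.apply_inv_self] at e0' e1'
    obtain ⟨hv, hu, -⟩ := m.eq_of_tile_mapsTo hτ hg h₁ h' e0'.symm e1'.symm
    rw [← m.lmul_lflip_injective hτ (add_right_cancel hv), ← m.lmul_lflip_injective hτ hu] at h₁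
    exact h₁ h
  · obtain ⟨v', u', h', e0, e1⟩ := m.exists_tile_of_mem_symmetryGroup hmem h
    obtain ⟨rfl, rfl, hb⟩ := m.eq_of_tile_mapsTo hτ hg h h' e0 e1
    exact hb

/-- Both ends of the edge from the origin to `(1, 0)` go to vertices. Their images determine the
translation part and show that the linear part is given by a lattice unit. -/
lemma exists_lattice_isometry
    (hmem : g ∈ symmetryGroup (m.pattern.tiles (m.placement initialAngle))) :
    ∃ f τ w, lnorm m.c τ = 1 ∧
      ∀ z, g z = emb m.c τ * flip f z + 2 * Real.cos initialAngle * emb m.c w := by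
  obtain ⟨f, a, ha⟩ := isometry_eq g
  have h := m.row_zero 0
  have hm : m.bend ((0, 0) + (1, 0)) (-(1, 0)) ≠ 0 := by
    rw [m.bend_mate]; exact neg_ne_zero.2 h
  obtain ⟨v₁, u₁, h₁, e₁, -⟩ := m.exists_tile_of_mem_symmetryGroup hmem h
  obtain ⟨v₂, u₂, h₂, e₂, -⟩ := m.exists_tile_of_mem_symmetryGroup hmem hm
  rw [tileMap_zero, tileMap_zero] at e₁ e₂
  have z0 : emb m.c (0, 0) = 0 := emb_zero
  rw [z0, mul_zero] at e₁
  rw [emb_add, z0, emb_one, zero_add, ha, e₁, flip_two_mul_ofReal_mul] at e₂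
  have f1 : flip f 1 = 1 := by cases f <;> simp [flip]
  rw [f1] at e₂
  have hau : a = emb m.c (v₂ - v₁) := by
    apply mul_left_cancel₀ two_cos_ne_zero
    rw [emb_sub]
    linear_combination e₂
  refine ⟨f, v₂ - v₁, v₁, ?_, fun z => by rw [ha, e₁, hau]⟩
  rw [← norm_emb_eq_one m.hc, ← hau]
  have hd := g.dist_eq 1 0
  rw [ha 1, f1, dist_eq_norm, dist_eq_norm] at hd
  simpa using hd

lemma mem_symmetryGroup_of_isSymmetry (hτ : lnorm m.c τ = 1)
    (hg : ∀ z, g z = emb m.c τ * flip f z + 2 * Real.cos initialAngle * emb m.c w)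
    (hs : m.IsSymmetry f τ w) :
    g ∈ symmetryGroup (m.pattern.tiles (m.placement initialAngle)) := by
  have hne : ∀ b : ℤ, flipSign f * b ≠ 0 ↔ b ≠ 0 := by
    intro b; cases f <;> simp [flipSign]
  have himage : ∀ v u, lnorm m.c u = 1 → g '' (m.tileMap initialAngle v u '' kite) =
      m.tileMap initialAngle (lmul m.c τ (lflip m.c f v) + w) (lmul m.c τ (lflip m.c f u)) ''
        kite := by
    intro v u hu
    conv_rhs => rw [← flip_image_kite f]
    rw [← Set.image_comp, ← Set.image_comp]
    congr 1
    funext z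
    simp only [Function.comp_apply, tileMap, turn, hs v u hu, hg, flip_add, flip_mul,
      flip_two, flip_ofReal, flip_exp, emb_add, emb_lmul m.hc, emb_lflip]
    ring
  -- The inverse of the linear part is again integral, so every tile is the image of a half-edge of
  -- the lattice.
  have hinv : ∀ v, lmul m.c τ (lflip m.c f (lflip m.c f (lmul m.c (lconj m.c τ) v))) = v := by
    intro v
    apply emb_injective m.hc
    rw [emb_lmul m.hc, emb_lflip, emb_lflip, flip_flip, emb_lmul m.hc, emb_lconj, ← mul_assoc,
      unit_mul_conj m.hc hτ, one_mul]
  intro S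
  constructor
  · intro hS
    obtain ⟨v', u', h', e⟩ := m.mem_tiles.1 hS
    have hu' := (m.unit_of_bend _ _ h').2
    have hu := lnorm_lflip m.hc f (lnorm_lmul m.hc (lnorm_lconj m.hc hτ) hu')
    have hi := himage (lflip m.c f (lmul m.c (lconj m.c τ) (v' - w))) _ hu
    have hb := hs (lflip m.c f (lmul m.c (lconj m.c τ) (v' - w))) _ hu
    rw [hinv, hinv, sub_add_cancel] at hi hb
    rw [← hi] at e
    rw [hb, hne] at h'
    exact m.mem_tiles.2 ⟨_, _, h', g.injective.image_injective e⟩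
  · intro hS
    obtain ⟨v, u, h, rfl⟩ := m.mem_tiles.1 hS
    have hu := (m.unit_of_bend _ _ h).2
    refine m.mem_tiles.2 ⟨_, _, ?_, himage v u hu⟩
    rw [hs v u hu, hne]
    exact h

end symmetry

end Mesh

/-! ### Recognition of the wallpaper group -/

lemma emb_zsmul {c : ℤ} (n : ℤ) (v : ℤ × ℤ) : emb c (n • v) = n * emb c v := by
  simp [emb]; ring

/-- Powers in lattice coordinates. -/
def lpow (c : ℤ) (u : ℤ × ℤ) : ℕ → ℤ × ℤ
  | 0 => (1, 0)
  | n + 1 => lmul c u (lpow c u n)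

lemma zpow_translation {g : ℂ ≃ᵢ ℂ} {t : ℂ} (hg : ∀ z, g z = z + t) (n : ℤ) (z : ℂ) :
    (g ^ n) z = z + n * t := by
  induction n using Int.induction_on generalizing z with
  | zero => simp
  | succ n ih =>
    rw [zpow_add_one, IsometryEquiv.mul_apply, hg, ih]
    push_cast
    ring
  | pred n ih =>
    have h : g⁻¹ z = z - t := by
      apply g.injective
      rw [IsometryEquiv.apply_inv_self, hg, sub_add_cancel]
    rw [zpow_sub_one, IsometryEquiv.mul_apply, h, ih]
    push_cast
    ring

namespace WallpaperType

/-- The matrix `rotation`, which has integer entries. -/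
def intRotation : WallpaperType → Matrix (Fin 2) (Fin 2) ℤ
  | p1 | pm | pg | cm => !![1, 0; 0, 1]
  | p2 | pmm | pmg | pgg | cmm => !![-1, 0; 0, -1]
  | p4 | p4m | p4g => !![0, -1; 1, 0]
  | p3 | p3m1 | p31m => !![0, -1; 1, -1]
  | p6 | p6m => !![1, -1; 1, 0]

/-- The map `reflection`: its linear part and twice its translation part. -/
def intReflection : WallpaperType → Option (Matrix (Fin 2) (Fin 2) ℤ × (Fin 2 → ℤ))
  | p1 | p2 | p4 | p3 | p6 => none
  | pm | pmm | p4m => some (!![-1, 0; 0, 1], ![0, 0])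
  | pg => some (!![-1, 0; 0, 1], ![0, 1])
  | pmg => some (!![-1, 0; 0, 1], ![1, 0])
  | pgg | p4g => some (!![-1, 0; 0, 1], ![1, 1])
  | cm | cmm | p31m | p6m => some (!![0, 1; 1, 0], ![0, 0])
  | p3m1 => some (!![0, -1; -1, 0], ![0, 0])

lemma rotation_mulVec (X : WallpaperType) (v : Fin 2 → ℝ) (i : Fin 2) :
    X.rotation.mulVec v i = X.intRotation i 0 * v 0 + X.intRotation i 1 * v 1 := by
  cases X <;> fin_cases i <;>
    simp [rotation, intRotation, Matrix.mulVec, dotProduct, Fin.sum_univ_two, Matrix.one_apply]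

lemma exists_reflection (X : WallpaperType) {S : Matrix (Fin 2) (Fin 2) ℤ × (Fin 2 → ℤ)}
    (hS : S ∈ X.intReflection) :
    (S.1.map (Int.cast : ℤ → ℝ), fun i => (S.2 i : ℝ) / 2) ∈ X.reflection := by
  cases X <;> simp only [intReflection, reflection, Option.mem_def, Option.some.injEq,
    reduceCtorEq] at hS ⊢ <;> subst hS <;>
    refine Prod.ext (Matrix.ext fun i j => ?_) (funext fun i => ?_) <;> fin_cases i <;>
    (try fin_cases j) <;> simp

lemma eq_of_mem_reflection (X : WallpaperType)
    {S : Matrix (Fin 2) (Fin 2) ℝ × (Fin 2 → ℝ)} (hS : S ∈ X.reflection) :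
    ∃ S' ∈ X.intReflection, S = (S'.1.map (Int.cast : ℤ → ℝ), fun i => (S'.2 i : ℝ) / 2) := by
  cases h : X.intReflection with
  | none => cases X <;> simp_all [intReflection, reflection]
  | some S' => exact ⟨S', rfl, Option.mem_unique hS (X.exists_reflection h)⟩

end WallpaperType

/-- A description of a wallpaper group in lattice coordinates: two periods, twice the origin of
the frame, the rotation generator `z ↦ rotUnit * z + rotShift` and the (glide) reflection
`z ↦ reflUnit * conj z + reflShift`, if there is one. -/
structure GroupData where
  A : ℤ × ℤ
  B : ℤ × ℤ
  origin : ℤ × ℤ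
  rotUnit : ℤ × ℤ
  rotShift : ℤ × ℤ
  reflUnit : ℤ × ℤ
  reflShift : ℤ × ℤ

namespace Mesh

variable (m : Mesh)

/-- The symmetries of the mesh form the wallpaper group of type `X` that `D` describes. -/
structure HasGroup (X : WallpaperType) (D : GroupData) : Prop where
  indep : D.A.1 * D.B.2 - D.A.2 * D.B.1 ≠ 0
  rot_unit : lnorm m.c D.rotUnit = 1
  rot_A : lmul m.c D.rotUnit D.A = X.intRotation 0 0 • D.A + X.intRotation 1 0 • D.B
  rot_B : lmul m.c D.rotUnit D.B = X.intRotation 0 1 • D.A + X.intRotation 1 1 • D.B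
  -- The origin of the frame is `origin / 2`, which allows rotation centres off the lattice; the
  -- equation that fixes it is doubled to remain integral.
  rot_origin : D.origin = lmul m.c D.rotUnit D.origin + (2 : ℤ) • D.rotShift
  rot_sym : m.IsSymmetry false D.rotUnit D.rotShift
  trans_A : m.IsSymmetry false (1, 0) D.A
  trans_B : m.IsSymmetry false (1, 0) D.B
  rot_only : ∀ τ w, lnorm m.c τ = 1 → m.IsSymmetry false τ w → ∃ e, lpow m.c D.rotUnit e = τ
  trans_only : ∀ w, m.IsSymmetry false (1, 0) w → ∃ p q : ℤ, w = p • D.A + q • D.B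
  refl : ∀ S ∈ X.intReflection, lnorm m.c D.reflUnit = 1 ∧
    lmul m.c D.reflUnit (lconj m.c D.A) = S.1 0 0 • D.A + S.1 1 0 • D.B ∧
    lmul m.c D.reflUnit (lconj m.c D.B) = S.1 0 1 • D.A + S.1 1 1 • D.B ∧
    D.origin + S.2 0 • D.A + S.2 1 • D.B =
      lmul m.c D.reflUnit (lconj m.c D.origin) + (2 : ℤ) • D.reflShift ∧
    m.IsSymmetry true D.reflUnit D.reflShift
  refl_none : X.intReflection = none → ∀ τ w, lnorm m.c τ = 1 → ¬m.IsSymmetry true τ w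

/-- The frame of the plane that belongs to `D`. -/
noncomputable def groupFrame (D : GroupData) : (Fin 2 → ℝ) → ℂ :=
  frame (Real.cos initialAngle * emb m.c D.origin) (2 * Real.cos initialAngle * emb m.c D.A)
    (2 * Real.cos initialAngle * emb m.c D.B)

/-- The symmetry group of the initial configuration. -/
noncomputable abbrev symmetries : Subgroup (ℂ ≃ᵢ ℂ) :=
  symmetryGroup (m.pattern.tiles (m.placement initialAngle))

namespace HasGroup

variable {m} {X : WallpaperType} {D : GroupData}

lemma linearIndependent (h : m.HasGroup X D) : LinearIndependent ℝ
    ![2 * Real.cos initialAngle * emb m.c D.A, 2 * Real.cos initialAngle * emb m.c D.B] := by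
  rw [LinearIndependent.pair_iff]
  intro s t hst
  have h1 : (s : ℂ) * emb m.c D.A + t * emb m.c D.B = 0 := by
    apply mul_left_cancel₀ two_cos_ne_zero
    simp only [Complex.real_smul] at hst
    linear_combination hst
  have hi := congrArg Complex.im h1
  have hr := congrArg Complex.re h1
  simp only [Complex.add_im, Complex.add_re, Complex.re_ofReal_mul, Complex.im_ofReal_mul, emb_re,
    emb_im, Complex.zero_re, Complex.zero_im] at hi hr
  have hi' : s * D.A.2 + t * D.B.2 = 0 := by
    apply mul_right_cancel₀ (zeta_im_pos m.hc).ne'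
    linear_combination hi
  have hr' : s * D.A.1 + t * D.B.1 = 0 := by linear_combination hr - m.c / 2 * hi'
  have hd : (D.A.1 * D.B.2 - D.A.2 * D.B.1 : ℝ) ≠ 0 := by exact_mod_cast h.indep
  constructor
  · apply mul_right_cancel₀ hd
    linear_combination D.B.2 * hr' - D.B.1 * hi'
  · apply mul_right_cancel₀ hd
    linear_combination D.A.1 * hi' - D.A.2 * hr'

lemma exists_rotation (h : m.HasGroup X D) : ∃ g ∈ m.symmetries,
    (∀ z, g z = emb m.c D.rotUnit * z + 2 * Real.cos initialAngle * emb m.c D.rotShift) ∧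
    ∀ v, g (m.groupFrame D v) = m.groupFrame D (X.rotation.mulVec v) := by
  obtain ⟨g, hg⟩ := exists_isometry false ((norm_emb_eq_one m.hc).2 h.rot_unit)
    (2 * Real.cos initialAngle * emb m.c D.rotShift)
  refine ⟨g, m.mem_symmetryGroup_of_isSymmetry h.rot_unit hg h.rot_sym, hg, fun v => ?_⟩
  have hA := congrArg (emb m.c) h.rot_A
  have hB := congrArg (emb m.c) h.rot_B
  have ho := congrArg (emb m.c) h.rot_origin
  simp only [emb_add, emb_lmul m.hc, emb_zsmul] at hA hB ho
  push_cast at ho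
  rw [hg]
  simp only [flip, Bool.false_eq_true, if_false, groupFrame, frame, X.rotation_mulVec]
  generalize Real.cos initialAngle = s
  push_cast
  linear_combination (2 * s * v 0 : ℂ) * hA +
    (2 * s * v 1 : ℂ) * hB - (s : ℂ) * ho

lemma exists_rotation_pow (h : m.HasGroup X D) (e : ℕ) : ∃ g ∈ m.symmetries,
    (∃ w, ∀ z, g z = emb m.c (lpow m.c D.rotUnit e) * z +
      2 * Real.cos initialAngle * emb m.c w) ∧
    ∀ v, g (m.groupFrame D v) = m.groupFrame D ((X.rotation ^ e).mulVec v) := by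
  obtain ⟨r, hr, hr1, hr2⟩ := h.exists_rotation
  induction e with
  | zero => exact ⟨1, one_mem _, ⟨0, fun z => by simp [lpow]⟩, fun v => by simp⟩
  | succ e ih =>
    obtain ⟨g, hg, ⟨w, hg1⟩, hg2⟩ := ih
    refine ⟨r * g, mul_mem hr hg, ⟨lmul m.c D.rotUnit w + D.rotShift, fun z => ?_⟩, fun v => ?_⟩
    · rw [IsometryEquiv.mul_apply, hg1, hr1, lpow, emb_lmul m.hc, emb_add, emb_lmul m.hc]
      ring
    · rw [IsometryEquiv.mul_apply, hg2, hr2, Matrix.mulVec_mulVec, ← pow_succ']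

lemma exists_reflection (h : m.HasGroup X D) {S : Matrix (Fin 2) (Fin 2) ℝ × (Fin 2 → ℝ)}
    (hS : S ∈ X.reflection) : ∃ g ∈ m.symmetries, lnorm m.c D.reflUnit = 1 ∧
    (∀ z, g z = emb m.c D.reflUnit * conj z +
      2 * Real.cos initialAngle * emb m.c D.reflShift) ∧
    ∀ v, g (m.groupFrame D v) = m.groupFrame D (S.1.mulVec v + S.2) := by
  obtain ⟨S', hS', rfl⟩ := X.eq_of_mem_reflection hS
  obtain ⟨hu, hA, hB, ho, hs⟩ := h.refl S' hS'
  obtain ⟨g, hg⟩ := exists_isometry true ((norm_emb_eq_one m.hc).2 hu)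
    (2 * Real.cos initialAngle * emb m.c D.reflShift)
  refine ⟨g, m.mem_symmetryGroup_of_isSymmetry hu hg hs, hu, hg, fun v => ?_⟩
  replace hA := congrArg (emb m.c) hA
  replace hB := congrArg (emb m.c) hB
  replace ho := congrArg (emb m.c) ho
  simp only [emb_add, emb_lmul m.hc, emb_lconj, emb_zsmul] at hA hB ho
  push_cast at ho
  rw [hg]
  simp only [flip, if_true, groupFrame, frame, Matrix.mulVec, dotProduct, Fin.sum_univ_two,
    Matrix.map_apply, Pi.add_apply, map_add, map_mul, Complex.conj_ofReal, map_ofNat]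
  generalize Real.cos initialAngle = s
  push_cast
  linear_combination (2 * s * v 0 : ℂ) * hA +
    (2 * s * v 1 : ℂ) * hB - (s : ℂ) * ho

lemma groupFrame_add (p q : ℤ) (v n : Fin 2 → ℝ) (h0 : n 0 = p) (h1 : n 1 = q) :
    m.groupFrame D (v + n) = m.groupFrame D v +
      2 * Real.cos initialAngle * (p * emb m.c D.A + q * emb m.c D.B) := by
  simp only [groupFrame, frame, Pi.add_apply, h0, h1]
  generalize Real.cos initialAngle = s
  push_cast
  ring

lemma exists_translation (h : m.HasGroup X D) (p q : ℤ) : ∃ g ∈ m.symmetries, ∀ z,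
    g z = z + 2 * Real.cos initialAngle * (p * emb m.c D.A + q * emb m.c D.B) := by
  have key : ∀ w, m.IsSymmetry false (1, 0) w → ∃ g ∈ m.symmetries, ∀ z,
      g z = z + 2 * Real.cos initialAngle * emb m.c w := by
    intro w hw
    have h1 : lnorm m.c (1, 0) = 1 := by simp [lnorm]
    obtain ⟨g, hg⟩ := exists_isometry false ((norm_emb_eq_one m.hc).2 h1)
      (2 * Real.cos initialAngle * emb m.c w)
    exact ⟨g, m.mem_symmetryGroup_of_isSymmetry h1 hg hw, fun z => by
      rw [hg, emb_one, one_mul]; rfl⟩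
  obtain ⟨gA, hA, hA'⟩ := key _ h.trans_A
  obtain ⟨gB, hB, hB'⟩ := key _ h.trans_B
  refine ⟨gA ^ p * gB ^ q, mul_mem (zpow_mem hA _) (zpow_mem hB _), fun z => ?_⟩
  rw [IsometryEquiv.mul_apply, zpow_translation hA', zpow_translation hB']
  ring

/-- The direct symmetries. -/
lemma eq_of_direct (h : m.HasGroup X D) {g : ℂ ≃ᵢ ℂ} (hg : g ∈ m.symmetries) {τ w : ℤ × ℤ}
    (hτ : lnorm m.c τ = 1)
    (hg' : ∀ z, g z = emb m.c τ * z + 2 * Real.cos initialAngle * emb m.c w) :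
    ∃ (e : ℕ) (n : Fin 2 → ℤ), ∀ v, g (m.groupFrame D v) =
      m.groupFrame D ((X.rotation ^ e).mulVec v + fun i => (n i : ℝ)) := by
  obtain ⟨e, rfl⟩ := h.rot_only τ w hτ (m.isSymmetry_of_mem hτ hg' hg)
  obtain ⟨r, hr, ⟨w', hr1⟩, hr2⟩ := h.exists_rotation_pow e
  -- Dividing by the power of the rotation with the same linear part leaves a translation, which
  -- `trans_only` describes.
  have ht : ∀ y, (g * r⁻¹) y = emb m.c (1, 0) * flip false y +
      2 * Real.cos initialAngle * emb m.c (w - w') := by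
    intro y
    obtain ⟨z, rfl⟩ := r.surjective y
    rw [IsometryEquiv.mul_apply, IsometryEquiv.inv_apply_self, hg', emb_one, emb_sub, flip,
      if_neg Bool.false_ne_true, hr1]
    ring
  obtain ⟨p, q, hpq⟩ := h.trans_only _
    (m.isSymmetry_of_mem (by simp [lnorm]) ht (mul_mem hg (inv_mem hr)))
  refine ⟨e, ![p, q], fun v => ?_⟩
  have h1 := ht (r (m.groupFrame D v))
  rw [IsometryEquiv.mul_apply, IsometryEquiv.inv_apply_self, hr2, hpq, emb_one, one_mul, emb_add,
    emb_zsmul, emb_zsmul, flip, if_neg Bool.false_ne_true] at h1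
  rw [h1, groupFrame_add p q _ _ (by simp) (by simp)]

/-- The model consists of products of a translation, a rotation power and possibly the chosen
reflection. Direct symmetries are handled by `eq_of_direct`; an indirect one becomes direct after
division by the reflection. Conversely, each factor is realised by a symmetry. -/
theorem isWallpaperGroup (h : m.HasGroup X D) : IsWallpaperGroup m.symmetries X := by
  refine ⟨Real.cos initialAngle * emb m.c D.origin, _, _, h.linearIndependent, ?_, ?_⟩
  · intro g hg
    obtain ⟨f, τ, w, hτ, hgf⟩ := m.exists_lattice_isometry hg
    cases f
    · obtain ⟨e, n, he⟩ := h.eq_of_direct hg hτ hgf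
      exact ⟨fun v => (X.rotation ^ e).mulVec v + fun i => (n i : ℝ),
        Or.inl ⟨e, n, fun _ => rfl⟩, he⟩
    · cases hX : X.intReflection with
      | none => exact absurd (m.isSymmetry_of_mem hτ hgf hg) (h.refl_none hX τ w hτ)
      | some S =>
        have hS := X.exists_reflection hX
        obtain ⟨s, hs, hu, hs1, hs2⟩ := h.exists_reflection hS
        have hd : ∀ y, (g * s⁻¹) y = emb m.c (lmul m.c τ (lconj m.c D.reflUnit)) * y +
            2 * Real.cos initialAngle *
              emb m.c (w - lmul m.c (lmul m.c τ (lconj m.c D.reflUnit)) D.reflShift) := by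
          intro y
          obtain ⟨z, rfl⟩ := s.surjective y
          rw [IsometryEquiv.mul_apply, IsometryEquiv.inv_apply_self, hgf, hs1, flip, if_pos rfl]
          simp only [emb_sub, emb_lmul m.hc, emb_lconj]
          linear_combination (-emb m.c τ * conj z) * unit_mul_conj m.hc hu
        obtain ⟨e, n, he⟩ := h.eq_of_direct (mul_mem hg (inv_mem hs))
          (lnorm_lmul m.hc hτ (lnorm_lconj m.hc hu)) hd
        refine ⟨_, Or.inr ⟨_, hS, e, n, fun _ => rfl⟩, fun v => ?_⟩
        change g (m.groupFrame D v) = m.groupFrame D _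
        rw [← he, ← hs2, IsometryEquiv.mul_apply, IsometryEquiv.inv_apply_self]
  · rintro f (⟨e, n, hf⟩ | ⟨S, hS, e, n, hf⟩)
    · obtain ⟨t, ht, ht'⟩ := h.exists_translation (n 0) (n 1)
      obtain ⟨r, hr, -, hr'⟩ := h.exists_rotation_pow e
      refine ⟨t * r, mul_mem ht hr, fun v => ?_⟩
      change (t * r) (m.groupFrame D v) = m.groupFrame D (f v)
      rw [IsometryEquiv.mul_apply, hr', ht', hf, groupFrame_add (n 0) (n 1) _ _ rfl rfl]
    · obtain ⟨t, ht, ht'⟩ := h.exists_translation (n 0) (n 1)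
      obtain ⟨r, hr, -, hr'⟩ := h.exists_rotation_pow e
      obtain ⟨s, hs, -, -, hs'⟩ := h.exists_reflection hS
      refine ⟨t * (r * s), mul_mem ht (mul_mem hr hs), fun v => ?_⟩
      change (t * (r * s)) (m.groupFrame D v) = m.groupFrame D (f v)
      rw [IsometryEquiv.mul_apply, IsometryEquiv.mul_apply, hs', hr', ht', hf,
        groupFrame_add (n 0) (n 1) _ _ rfl rfl]

end HasGroup

end Mesh

/-! ### Meshes given by tables -/

/-- A mesh given by a table. The table lists, for the vertices `(x, y)` with `x, y < M` in
lexicographic order, the bends of the edges in the directions `(1, 0)`, `(0, 1)` and `(-1, 1)`. -/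
structure Design where
  c : ℤ
  M : ℕ
  table : List (ℤ × ℤ × ℤ)
  group : GroupData

namespace Design

variable (d : Design)

/-- The bends of the edges that start at `v` in positive direction. -/
def edges (v : ℤ × ℤ) : ℤ × ℤ × ℤ :=
  d.table.getD ((v.1 % d.M) * d.M + v.2 % d.M).toNat (0, 0, 0)

/-- The bend at the vertex `v` in direction `u`. -/
def bend (v u : ℤ × ℤ) : ℤ :=
  if u = (1, 0) then (d.edges v).1
  else if u = (0, 1) then (d.edges v).2.1
  else if u = (-1, 1) then (d.edges v).2.2
  else if u = (-1, 0) then -(d.edges (v + u)).1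
  else if u = (0, -1) then -(d.edges (v + u)).2.1
  else if u = (1, -1) then -(d.edges (v + u)).2.2
  else 0

/-- The remainder of a vertex modulo the periods. -/
def reduce (v : ℤ × ℤ) : ℤ × ℤ := (v.1 % d.M, v.2 % d.M)

lemma edges_congr {v w : ℤ × ℤ} (h : d.reduce v = d.reduce w) : d.edges v = d.edges w := by
  simp only [reduce, Prod.mk.injEq] at h
  rw [edges, edges, h.1, h.2]

lemma reduce_add_congr {v w : ℤ × ℤ} (h : d.reduce v = d.reduce w) (t : ℤ × ℤ) :
    d.reduce (v + t) = d.reduce (w + t) := by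
  simp only [reduce, Prod.mk.injEq, Prod.fst_add, Prod.snd_add] at h ⊢
  exact ⟨Int.ModEq.add_right t.1 h.1, Int.ModEq.add_right t.2 h.2⟩

lemma bend_congr {v w : ℤ × ℤ} (h : d.reduce v = d.reduce w) (u : ℤ × ℤ) :
    d.bend v u = d.bend w u := by
  rw [bend, bend, d.edges_congr h, d.edges_congr (d.reduce_add_congr h u)]

lemma reduce_reduce (v : ℤ × ℤ) : d.reduce (d.reduce v) = d.reduce v := by
  simp [reduce]

lemma bend_eq_zero {v u : ℤ × ℤ} (hu : u ∉ latticeUnits) : d.bend v u = 0 := by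
  simp only [latticeUnits, Finset.mem_insert, Finset.mem_singleton, not_or] at hu
  simp [bend, hu]

lemma neg_mem_latticeUnits {u : ℤ × ℤ} (hu : -u ∈ latticeUnits) : u ∈ latticeUnits := by
  have : ∀ u ∈ latticeUnits, -u ∈ latticeUnits := by decide
  simpa using this _ hu

/-- The lattice isometry preserves the bends of all edges at vertices of the unit cell. -/
def Preserves (f : Bool) (τ w : ℤ × ℤ) : Prop :=
  ∀ x < d.M, ∀ y < d.M, ∀ u ∈ latticeUnits, lnorm d.c u = 1 →
    d.bend (lmul d.c τ (lflip d.c f (x, y)) + w) (lmul d.c τ (lflip d.c f u)) =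
      flipSign f * d.bend (x, y) u

instance (f : Bool) (τ w : ℤ × ℤ) : Decidable (d.Preserves f τ w) := by
  unfold Preserves; infer_instance

/-- The conditions of a mesh at the vertex `(x, y)` in direction `u`. -/
def IsMeshAt (x y : ℕ) (u : ℤ × ℤ) : Prop :=
  (d.bend (x, y) u = 0 ∨ d.bend (x, y) u = 1 ∨ d.bend (x, y) u = -1) ∧
  (d.bend (x, y) u ≠ 0 → lnorm d.c u = 1) ∧
  d.bend (((x : ℤ), (y : ℤ)) + u) (-u) = -d.bend (x, y) u ∧
  (d.bend (x, y) u ≠ 0 → x = 0 ∨ ∀ x' < d.M, d.bend (x', y) (1, 0) ≠ 0)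

instance (x y : ℕ) (u : ℤ × ℤ) : Decidable (d.IsMeshAt x y u) := by
  unfold IsMeshAt; infer_instance

/-- The conditions on the table of a mesh. -/
def IsMesh : Prop :=
  (d.c = 0 ∨ d.c = 1) ∧ 0 < d.M ∧
  (∀ x < d.M, ∀ y < d.M, ∀ u ∈ latticeUnits, d.IsMeshAt x y u) ∧
  (∀ x < d.M, d.bend (x, 0) (1, 0) ≠ 0) ∧
  ∀ y < d.M, d.bend (0, y) (0, 1) ≠ 0

instance : Decidable d.IsMesh := by unfold IsMesh; infer_instance

variable {d}

lemma IsMesh.exists_nat (h : d.IsMesh) (z : ℤ) : ∃ x < d.M, (x : ℤ) = z % d.M := by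
  have hM : (0 : ℤ) < d.M := by exact_mod_cast h.2.1
  have h0 := Int.emod_nonneg z hM.ne'
  have h1 := Int.emod_lt_of_pos z hM
  exact ⟨(z % d.M).toNat, by omega, by omega⟩

lemma IsMesh.exists_reduce (h : d.IsMesh) (v : ℤ × ℤ) :
    ∃ x < d.M, ∃ y < d.M, d.reduce v = d.reduce ((x : ℤ), (y : ℤ)) ∧ (x : ℤ) = v.1 % d.M ∧
      (y : ℤ) = v.2 % d.M := by
  obtain ⟨x, hx, hx'⟩ := h.exists_nat v.1
  obtain ⟨y, hy, hy'⟩ := h.exists_nat v.2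
  refine ⟨x, hx, y, hy, ?_, hx', hy'⟩
  rw [hx', hy']
  exact (d.reduce_reduce v).symm

/-- The mesh of a table. -/
def IsMesh.mesh (h : d.IsMesh) : Mesh where
  c := d.c
  hc := h.1
  M := d.M
  M_pos := h.2.1
  bend := d.bend
  bend_periodic v w u := d.bend_congr (by simp [reduce]) u
  bend_sign v u := by
    by_cases hu : u ∈ latticeUnits
    · obtain ⟨x, hx, y, hy, hv, -⟩ := h.exists_reduce v
      rw [d.bend_congr hv]
      exact (h.2.2.1 x hx y hy u hu).1
    · exact Or.inl (d.bend_eq_zero hu)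
  unit_of_bend v u hb := by
    have hu : u ∈ latticeUnits := by
      by_contra hu
      exact hb (d.bend_eq_zero hu)
    obtain ⟨x, hx, y, hy, hv, -⟩ := h.exists_reduce v
    rw [d.bend_congr hv] at hb
    exact ⟨hu, (h.2.2.1 x hx y hy u hu).2.1 hb⟩
  bend_mate v u := by
    by_cases hu : u ∈ latticeUnits
    · obtain ⟨x, hx, y, hy, hv, -⟩ := h.exists_reduce v
      rw [d.bend_congr hv, d.bend_congr (d.reduce_add_congr hv u)]
      exact (h.2.2.1 x hx y hy u hu).2.2.1
    · rw [d.bend_eq_zero hu, d.bend_eq_zero fun hu' => hu (neg_mem_latticeUnits hu'), neg_zero]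
  row_zero x := by
    obtain ⟨x', hx, hx'⟩ := h.exists_nat x
    rw [d.bend_congr (w := (x', 0)) (by simp [reduce, hx'])]
    exact h.2.2.2.1 x' hx
  column_zero y := by
    obtain ⟨y', hy, hy'⟩ := h.exists_nat y
    rw [d.bend_congr (w := (0, y')) (by simp [reduce, hy'])]
    exact h.2.2.2.2 y' hy
  row v u hb := by
    have hu : u ∈ latticeUnits := by
      by_contra hu
      exact hb (d.bend_eq_zero hu)
    obtain ⟨x, hx, y, hy, hv, hxv, hyv⟩ := h.exists_reduce v
    rw [d.bend_congr hv] at hb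
    rcases (h.2.2.1 x hx y hy u hu).2.2.2 hb with hx0 | hrow
    · left
      rw [hx0] at hxv
      exact Int.dvd_of_emod_eq_zero (by rw [← hxv]; rfl)
    · right
      intro z
      obtain ⟨x', hx, hx'⟩ := h.exists_nat z
      rw [d.bend_congr (w := (x', y)) (by simp [reduce, hx', hyv])]
      exact hrow x' hx

/-! ### Symmetries modulo the periods -/

lemma mem_latticeUnits {c : ℤ} (hc : c = 0 ∨ c = 1) {u : ℤ × ℤ} (hu : lnorm c u = 1) :
    u ∈ latticeUnits := by
  obtain ⟨x, y⟩ := u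
  obtain ⟨⟨a1, a2⟩, b1, b2⟩ := And.imp abs_le.1 abs_le.1 (abs_le_one_of_lnorm_eq_one hc hu)
  simp only [lnorm] at hu a1 a2 b1 b2
  rcases hc with rfl | rfl <;> interval_cases x <;> interval_cases y <;>
    simp [latticeUnits] at hu ⊢

/-- Lattice isometries have integer coefficients and so act on residues modulo `M`. This makes the
search for symmetries finite. -/
lemma reduce_act_congr {c : ℤ} {f : Bool} {τ v v' w w' : ℤ × ℤ} (hv : d.reduce v = d.reduce v')
    (hw : d.reduce w = d.reduce w') :
    d.reduce (lmul c τ (lflip c f v) + w) = d.reduce (lmul c τ (lflip c f v') + w') := by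
  simp only [reduce, Prod.mk.injEq, Prod.fst_add, Prod.snd_add] at hv hw ⊢
  have h1 : v.1 ≡ v'.1 [ZMOD d.M] := hv.1
  have h2 : v.2 ≡ v'.2 [ZMOD d.M] := hv.2
  have h3 : (lflip c f v).1 ≡ (lflip c f v').1 [ZMOD d.M] := by
    cases f
    · exact h1
    · exact h1.add (h2.mul_left c)
  have h4 : (lflip c f v).2 ≡ (lflip c f v').2 [ZMOD d.M] := by
    cases f
    · exact h2
    · exact h2.neg
  exact ⟨((h3.mul_left _).sub (h4.mul_left _)).add hw.1,
    (((h4.mul_left _).add (h3.mul_left _)).add (h4.mul_left _)).add hw.2⟩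

lemma IsMesh.isSymmetry_of_preserves (h : d.IsMesh) {f : Bool} {τ w : ℤ × ℤ}
    (hp : d.Preserves f τ w) : h.mesh.IsSymmetry f τ w := by
  intro v u hu
  obtain ⟨x, hx, y, hy, hv, -⟩ := h.exists_reduce v
  change d.bend _ _ = _ * d.bend v u
  rw [d.bend_congr hv, d.bend_congr (reduce_act_congr hv rfl)]
  exact hp x hx y hy u (mem_latticeUnits h.1 hu) hu

lemma IsMesh.preserves_of_isSymmetry (h : d.IsMesh) {f : Bool} {τ w w' : ℤ × ℤ}
    (hw : d.reduce w = d.reduce w') (hp : h.mesh.IsSymmetry f τ w) : d.Preserves f τ w' := by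
  intro x _ y _ u _ hu
  rw [d.bend_congr (reduce_act_congr rfl hw.symm)]
  exact hp (x, y) u hu

/-! ### Finite certificates for the group -/

variable (d)

/-- The conditions on the periods and the rotations of the group. -/
def HasRotations (X : WallpaperType) : Prop :=
  d.group.A.1 * d.group.B.2 - d.group.A.2 * d.group.B.1 ≠ 0 ∧
  lnorm d.c d.group.rotUnit = 1 ∧
  lmul d.c d.group.rotUnit d.group.A =
    X.intRotation 0 0 • d.group.A + X.intRotation 1 0 • d.group.B ∧
  lmul d.c d.group.rotUnit d.group.B =
    X.intRotation 0 1 • d.group.A + X.intRotation 1 1 • d.group.B ∧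
  d.group.origin = lmul d.c d.group.rotUnit d.group.origin + (2 : ℤ) • d.group.rotShift ∧
  d.Preserves false d.group.rotUnit d.group.rotShift ∧
  d.Preserves false (1, 0) d.group.A ∧ d.Preserves false (1, 0) d.group.B

instance (X : WallpaperType) : Decidable (d.HasRotations X) := by
  unfold HasRotations; infer_instance

/-- The conditions on the reflection of the group. -/
def HasReflection (X : WallpaperType) : Prop :=
  ∀ S ∈ X.intReflection.toList, lnorm d.c d.group.reflUnit = 1 ∧
    lmul d.c d.group.reflUnit (lconj d.c d.group.A) =
      S.1 0 0 • d.group.A + S.1 1 0 • d.group.B ∧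
    lmul d.c d.group.reflUnit (lconj d.c d.group.B) =
      S.1 0 1 • d.group.A + S.1 1 1 • d.group.B ∧
    d.group.origin + S.2 0 • d.group.A + S.2 1 • d.group.B =
      lmul d.c d.group.reflUnit (lconj d.c d.group.origin) + (2 : ℤ) • d.group.reflShift ∧
    d.Preserves true d.group.reflUnit d.group.reflShift

instance (X : WallpaperType) : Decidable (d.HasReflection X) := by
  unfold HasReflection; infer_instance

/-- The mesh has no other symmetries. -/
def HasNoOtherSymmetry (X : WallpaperType) : Prop :=
  ∀ τ ∈ latticeUnits, lnorm d.c τ = 1 → ∀ x < d.M, ∀ y < d.M,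
    -- Lattice units have multiplicative order at most `6`, so no larger exponents are needed.
    (d.Preserves false τ (x, y) → ∃ e < 6, lpow d.c d.group.rotUnit e = τ) ∧
    (X.intReflection.isNone = true → ¬d.Preserves true τ (x, y))

instance (X : WallpaperType) : Decidable (d.HasNoOtherSymmetry X) := by
  unfold HasNoOtherSymmetry; infer_instance

/-- The determinant of the periods of the group. -/
def det : ℤ := d.group.A.1 * d.group.B.2 - d.group.A.2 * d.group.B.1

/-- The mesh has no other translations. -/
def HasNoOtherTranslation : Prop :=
  (d.det ∣ d.M * d.group.A.1 ∧ d.det ∣ d.M * d.group.A.2 ∧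
    d.det ∣ d.M * d.group.B.1 ∧ d.det ∣ d.M * d.group.B.2) ∧
  ∀ x < d.M, ∀ y < d.M, d.Preserves false (1, 0) (x, y) →
    d.det ∣ x * d.group.B.2 - y * d.group.B.1 ∧ d.det ∣ d.group.A.1 * y - d.group.A.2 * x

instance : Decidable d.HasNoOtherTranslation := by
  unfold HasNoOtherTranslation; infer_instance

variable {d}

lemma IsMesh.hasGroup (h : d.IsMesh) {X : WallpaperType} (h1 : d.HasRotations X)
    (h2 : d.HasReflection X) (h3 : d.HasNoOtherSymmetry X) (h4 : d.HasNoOtherTranslation) :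
    h.mesh.HasGroup X d.group where
  indep := h1.1
  rot_unit := h1.2.1
  rot_A := h1.2.2.1
  rot_B := h1.2.2.2.1
  rot_origin := h1.2.2.2.2.1
  rot_sym := h.isSymmetry_of_preserves h1.2.2.2.2.2.1
  trans_A := h.isSymmetry_of_preserves h1.2.2.2.2.2.2.1
  trans_B := h.isSymmetry_of_preserves h1.2.2.2.2.2.2.2
  rot_only τ w hτ hs := by
    obtain ⟨x, hx, y, hy, hw, -⟩ := h.exists_reduce w
    obtain ⟨e, -, he⟩ := (h3 τ (mem_latticeUnits h.1 hτ) hτ x hx y hy).1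
      (h.preserves_of_isSymmetry hw hs)
    exact ⟨e, he⟩
  trans_only w hs := by
    obtain ⟨x, hx, y, hy, hw, hxw, hyw⟩ := h.exists_reduce w
    obtain ⟨⟨k1, k2, k3, k4⟩, h5⟩ := h4
    obtain ⟨k5, k6⟩ := h5 x hx y hy (h.preserves_of_isSymmetry hw hs)
    have e1 : w.1 = x + d.M * (w.1 / d.M) := by rw [hxw, Int.emod_add_mul_ediv]
    have e2 : w.2 = y + d.M * (w.2 / d.M) := by rw [hyw, Int.emod_add_mul_ediv]
    -- Cramer's rule: the coordinates of `w` in the basis `A`, `B` are these determinants divided by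
    -- `det`. The divisibilities `k1` to `k4` put all multiples of `M` into the span of `A` and `B`,
    -- so the residue of `w` decides.
    obtain ⟨p, hp⟩ : d.det ∣ w.1 * d.group.B.2 - w.2 * d.group.B.1 := by
      have : w.1 * d.group.B.2 - w.2 * d.group.B.1 = (x * d.group.B.2 - y * d.group.B.1) +
          (d.M * d.group.B.2 * (w.1 / d.M) - d.M * d.group.B.1 * (w.2 / d.M)) := by
        linear_combination d.group.B.2 * e1 - d.group.B.1 * e2
      rw [this]
      exact k5.add ((k4.mul_right _).sub (k3.mul_right _))
    obtain ⟨q, hq⟩ : d.det ∣ d.group.A.1 * w.2 - d.group.A.2 * w.1 := by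
      have : d.group.A.1 * w.2 - d.group.A.2 * w.1 = (d.group.A.1 * y - d.group.A.2 * x) +
          (d.M * d.group.A.1 * (w.2 / d.M) - d.M * d.group.A.2 * (w.1 / d.M)) := by
        linear_combination d.group.A.1 * e2 - d.group.A.2 * e1
      rw [this]
      exact k6.add ((k1.mul_right _).sub (k2.mul_right _))
    have hdet : d.det ≠ 0 := h1.1
    refine ⟨p, q, Prod.ext ?_ ?_⟩ <;> apply mul_left_cancel₀ hdet <;>
      simp only [Prod.fst_add, Prod.snd_add, Prod.smul_fst, Prod.smul_snd, smul_eq_mul]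
    · rw [det] at hp hq ⊢
      linear_combination d.group.A.1 * hp + d.group.B.1 * hq
    · rw [det] at hp hq ⊢
      linear_combination d.group.A.2 * hp + d.group.B.2 * hq
  refl S hS := by
    obtain ⟨r1, r2, r3, r4, r5⟩ := h2 S (Option.mem_toList.2 hS)
    exact ⟨r1, r2, r3, r4, h.isSymmetry_of_preserves r5⟩
  refl_none hX τ w hτ hs := by
    obtain ⟨x, hx, y, hy, hw, -⟩ := h.exists_reduce w
    exact (h3 τ (mem_latticeUnits h.1 hτ) hτ x hx y hy).2 (by rw [hX]; rfl)
      (h.preserves_of_isSymmetry hw hs)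

end Design

/-! ### The 17 patterns -/

/-- A mesh with the symmetry group of a given type. -/
def design : WallpaperType → Design
  -- For the types without reflections the last two entries of the group data are placeholders; for
  -- those without rotations the rotation is the identity.
  | .p1 => ⟨0, 2, [(1, 1, 0), (1, -1, 0), (-1, 1, 0), (-1, 1, 0)],
      ⟨(0, -2), (2, -2), (0, 0), (1, 0), (0, 0), (1, 0), (0, 0)⟩⟩
  | .pm => ⟨0, 2, [(1, 1, 0), (-1, -1, 0), (1, 1, 0), (-1, -1, 0)],
      ⟨(0, -2), (1, 0), (0, 1), (1, 0), (0, 0), (1, 0), (0, 1)⟩⟩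
  | .pg => ⟨0, 2, [(1, 1, 0), (1, 1, 0), (-1, 1, 0), (-1, 1, 0)],
      ⟨(0, -1), (2, 0), (0, 0), (1, 0), (0, 0), (1, 0), (1, 0)⟩⟩
  | .cm => ⟨0, 1, [(1, 1, 0)],
      ⟨(0, -1), (1, 0), (0, 0), (1, 0), (0, 0), (0, -1), (0, 0)⟩⟩
  | .p2 => ⟨1, 2, [(1, 1, 1), (1, -1, 1), (-1, 1, -1), (-1, -1, -1)],
      ⟨(0, -2), (2, -2), (0, 0), (-1, 0), (0, 0), (1, 0), (0, 0)⟩⟩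
  | .pmm => ⟨0, 2, [(1, 1, 0), (-1, 1, 0), (-1, -1, 0), (1, -1, 0)],
      ⟨(0, -2), (2, 0), (1, 1), (-1, 0), (1, 1), (1, 0), (0, 1)⟩⟩
  | .pmg => ⟨0, 2, [(1, 1, 0), (-1, -1, 0), (-1, 1, 0), (1, -1, 0)],
      ⟨(0, -2), (2, 0), (0, 0), (-1, 0), (0, 0), (1, 0), (0, -1)⟩⟩
  -- Only two of the three hexagonal directions carry edges, which gives a mesh of rhombi; the
  -- periods `A` and `B` are along their orthogonal diagonals.
  | .pgg => ⟨1, 2, [(1, 1, 0), (-1, -1, 0), (-1, -1, 0), (1, 1, 0)],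
      ⟨(1, -1), (1, 1), (0, 0), (-1, 0), (0, 0), (0, 1), (1, 0)⟩⟩
  | .cmm => ⟨0, 2, [(1, -1, 0), (0, 1, 0), (-1, 0, 0), (0, 0, 0)],
      ⟨(0, -2), (2, 0), (0, 0), (-1, 0), (0, 0), (0, -1), (0, 0)⟩⟩
  | .p4 => ⟨0, 2, [(1, 1, 0), (0, -1, 0), (-1, 0, 0), (0, 0, 0)],
      ⟨(0, -2), (2, 0), (0, 0), (0, 1), (0, 0), (1, 0), (0, 0)⟩⟩
  | .p4m => ⟨0, 2, [(1, -1, 0), (-1, -1, 0), (1, 1, 0), (-1, 1, 0)],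
      ⟨(0, -2), (2, 0), (1, 1), (0, 1), (1, 0), (1, 0), (0, 1)⟩⟩
  | .p4g => ⟨0, 2, [(1, 1, 0), (1, -1, 0), (-1, 1, 0), (-1, -1, 0)],
      ⟨(0, -2), (2, 0), (0, 0), (0, 1), (0, 0), (1, 0), (1, -1)⟩⟩
  | .p3 => ⟨1, 2, [(1, 1, 1), (1, -1, 1), (-1, -1, 1), (1, -1, -1)],
      ⟨(0, -2), (2, 0), (0, 0), (-1, 1), (0, 0), (1, 0), (0, 0)⟩⟩
  | .p3m1 => ⟨1, 1, [(1, -1, 1)],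
      ⟨(0, -1), (1, 0), (0, 0), (-1, 1), (0, 0), (0, 1), (0, 0)⟩⟩
  | .p31m => ⟨1, 3, [(1, -1, 1), (1, 1, 1), (-1, -1, -1),
      (-1, -1, -1), (1, -1, 1), (1, 1, 1), (1, 1, 1), (-1, -1, -1), (1, -1, 1)],
      ⟨(1, -2), (1, 1), (0, 0), (-1, 1), (0, 0), (1, -1), (0, 0)⟩⟩
  | .p6 => ⟨1, 2, [(1, 1, 1), (1, -1, -1), (-1, -1, 1), (-1, 1, -1)],
      ⟨(0, -2), (2, 0), (0, 0), (0, 1), (0, 0), (1, 0), (0, 0)⟩⟩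
  -- No edge meets the vertices congruent to `(1, 1)`, so this is the kagome net; the frame has its
  -- origin at `(1, 1)`, the centre of a hexagon.
  | .p6m => ⟨1, 2, [(1, -1, 0), (0, 1, -1), (-1, 0, 1), (0, 0, 0)],
      ⟨(0, -2), (2, 0), (2, 2), (0, 1), (2, -1), (0, -1), (2, 2)⟩⟩

lemma design_isMesh (X : WallpaperType) : (design X).IsMesh := by
  cases X <;> decide +kernel

lemma design_hasGroup (X : WallpaperType) :
    (design_isMesh X).mesh.HasGroup X (design X).group := by
  have h : (design X).HasRotations X ∧ (design X).HasReflection X ∧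
      (design X).HasNoOtherSymmetry X ∧ (design X).HasNoOtherTranslation := by
    cases X <;> decide +kernel
  exact (design_isMesh X).hasGroup h.1 h.2.1 h.2.2.1 h.2.2.2

end Kirigami

theorem theorem1 (X : Kirigami.WallpaperType) :
    ∃ (P : Kirigami.Pattern) (c : Kirigami.Placement P.n),
      P.IsConfiguration c ∧ P.IsDeployable c ∧
        Kirigami.IsWallpaperGroup (Kirigami.symmetryGroup (P.tiles c)) X := by
  let m := (Kirigami.design_isMesh X).mesh
  exact ⟨m.pattern, m.placement Kirigami.Mesh.initialAngle,
    m.isConfiguration _ (Kirigami.Mesh.isSmallAngle_of_mem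
      ⟨Kirigami.Mesh.initialAngle_pos.le, le_refl _⟩),
    m.isDeployable, (Kirigami.design_hasGroup X).isWallpaperGroup⟩
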